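/- **Model.** There are finitely many users and, for each ordered pair $(i,j)$ of distinct users, a source $X_{ij}$ to be conveyed from $i$ to $j$; source, reproduction, medium-input and medium-output alphabets are finite and time is discrete. Let $\mathcal A$ be a set of such pairs. For $(p,q)\in\mathcal A$ the source is i.i.d. with given marginal, $X_{pq}^n$ is its block of length $n$, and $d_{pq}:\mathcal X_{pq}\times\mathcal Y_{pq}\to[0,\infty)$ is a distortion function; for $(i,j)\notin\mathcal A$ the source is an arbitrary process $(X_{ij}(t))_{t\in\mathbb Z}$. All sources, the common randomness of the users and the initial state of the medium are independent. For block length $n$, the modem $h_i^n$ of user $i$ is, for each time $\tau\ge1$, a transition probability which produces letters $y_{ji}(\tau)$ (for all $j\ne i$) and a medium input $\iota_i(\tau)$ from the blocks $x_{ij}^n$, $(i,j)\in\mathcal A$ (available before time $1$: delay of these sources is immaterial), the letters $x_{ij}(t)$, $t\le\tau-1$, $(i,j)\notin\mathcal A$, the common randomness, and the medium outputs $o_i(t)$ and its own past outputs $y_{ji}(t),\iota_i(t)$, $1\le t\le\tau-1$; for $(j,i)\in\mathcal A$ it moreover forms a final reproduction $Y_{ji}^n\in\mathcal Y_{ji}^n$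 as a function of the whole process $y_{ji}(\cdot)$ and the common randomness. The medium is, for each $\tau\geq 1$, a transition probability which produces the outputs $o_i(\tau)$ at all users from its initial state and all $\iota_i(t),o_i(t)$, $1\le t\le\tau-1$. Given the past, all modems and the medium act independently. The source $X_{pq}$ is *communicated to within distortion $D$* if $$\lim_{n\to\infty}\Pr\Big(\tfrac1n\sum_{k=1}^n d_{pq}(X^n_{pq}[k],Y^n_{pq}[k])>D\Big)=0 .$$ $R_{X_{pq}}(D)\in[0,\infty]$ is the infimum of the rates $R\ge0$ for which there are source codes $\mathcal X_{pq}^n\to\{1,\dots,\lfloor2^{nR}\rfloor\}\to\mathcal Y_{pq}^n$ whose probability of average distortion $>D$ tends to $0$. A *message modem* is defined as a modem, except that for pairs in $\mathcal A$ a message from a finite set takes the place of the source block and a decoded message that of the final reproduction. **Theorem.** Let $h_i^n$ be modems, and for $(p,q)\in\mathcal A$ let $D'_{pq}>D_{pq}$ satisfy $R_{X_{pq}}(D'_{pq})<R_{X_{pq}}(D_{pq})$. Then there are additional common randomness $C'_n$ (independent of everything else), rates $R_{pq}$ with $R_{X_{pq}}(D'_{pq})<R_{pq}<R_{X_{pq}}(D_{pq})$,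 source codes $(s^n_{e,pq},s^n_{d,pq})$ with $\lfloor 2^{nR_{pq}}\rfloor$ messages which compress $X_{pq}$ to within distortion $D'_{pq}$ (the probability that the average distortion between $X_{pq}^n$ and $s^n_{d,pq}(s^n_{e,pq}(X_{pq}^n))$ exceeds $D'_{pq}$ tends to $0$), message modems $g_i^n$ for these message sets, and modems ${h'}_i^n$, none of them depending on the medium, such that: 1. ${h'}_i^n$ has the separation architecture: it source-codes each block $X_{ij}^n$, $(i,j)\in\mathcal A$, by $s^n_{e,ij}$, applies $g_i^n$ to the resulting messages, and applies $s^n_{d,ji}$ to the message decoded by $g_i^n$ for each $(j,i)\in\mathcal A$. If user $i$ belongs to no pair of $\mathcal A$, then ${h'}_i^n$ acts as $h_i^n$. 2. For every medium over which the modems $h_i^n$ communicate $X_{pq}$ to within distortion $D_{pq}$ for all $(p,q)\in\mathcal A$: * the modems $g_i^n$ communicate the messages reliably: for each $(p,q)\in\mathcal A$, the maximum over all messages (of $(p,q)$ and of the other pairs in $\mathcal A$) of the probability that the message of $(p,q)$ is decoded wrongly tends to $0$ as $n\to\infty$; * the modems ${h'}_i^n$ communicate $X_{pq}$ to within distortion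 $D'_{pq}$ for all $(p,q)\in\mathcal A$; * for all $n$ and $i$, the energy and bandwidth use of ${h'}_i^n$ is that of $h_i^n$: the medium input process of user $i$ has the same law under both sets of modems; * for all $n$, every source $X_{ij}$, $(i,j)\notin\mathcal A$, is received as before: the joint law of all $(X_{ij}(\cdot),Y_{ij}(\cdot))$, $(i,j)\notin\mathcal A$, where $Y_{ij}(\cdot)$ is the process of the letters $y_{ij}(\tau)$, $\tau\ge1$, and of all medium inputs and outputs is the same under both sets of modems. -/

import Mathlib

open MeasureTheory ProbabilityTheory Filter Topology
open scoped ENNReal NNReal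

namespace UnknownNetwork

/-! ### Rate-distortion -/

section RateDistortion

variable {X Y : Type}

/-- Average additive distortion `(1/n) ∑ₖ d(x[k], y[k])` between two blocks of length `n`. -/
noncomputable def avgDistortion (d : X → Y → ℝ≥0) {n : ℕ} (x : Fin n → X) (y : Fin n → Y) : ℝ :=
  (∑ k, (d (x k) (y k) : ℝ)) / n

/-- Number `⌊2 ^ (n R)⌋` of messages of a rate `R` code (in bits) of block length `n`. -/
noncomputable def msgCount (R : ℝ≥0) (n : ℕ) : ℕ := ⌊(2 : ℝ) ^ ((n : ℝ) * (R : ℝ))⌋₊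

variable [MeasurableSpace X]

/-- The source code `(enc, dec)` compresses the i.i.d. `μ` source to within distortion `D`: the
probability of excess distortion tends to `0` with the block length. -/
def CompressesWithin (μ : Measure X) (d : X → Y → ℝ≥0) (D : ℝ) {M : ℕ → ℕ}
    (enc : ∀ n, (Fin n → X) → Fin (M n)) (dec : ∀ n, Fin (M n) → (Fin n → Y)) : Prop :=
  Tendsto (fun n : ℕ => (Measure.pi fun _ : Fin n => μ)
    {x | D < avgDistortion d x (dec n (enc n x))}) atTop (𝓝 0)

/-- Rate `R` suffices to compress the i.i.d. `μ` source to within distortion `D`. -/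
def IsAchievableRate (μ : Measure X) (d : X → Y → ℝ≥0) (D : ℝ) (R : ℝ≥0) : Prop :=
  ∃ (enc : ∀ n, (Fin n → X) → Fin (msgCount R n)) (dec : ∀ n, Fin (msgCount R n) → (Fin n → Y)),
    CompressesWithin μ d D enc dec

/-- The rate-distortion function: the infimum of the achievable rates (`∞` if there is none). -/
noncomputable def rateDistortion (μ : Measure X) (d : X → Y → ℝ≥0) (D : ℝ) : ℝ≥0∞ :=
  ⨅ (R : ℝ≥0) (_ : IsAchievableRate μ d D R), (R : ℝ≥0∞)

end RateDistortion

/-! ### Users, signals, modems, medium -/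

/-- Ordered pairs `(i, j)` of distinct users: source `X_ij` goes from user `i` to user `j`. -/
abbrev UserPair (U : Type) := {p : U × U // p.1 ≠ p.2}

/-- The sending user of a pair. -/
abbrev UserPair.src {U : Type} (p : UserPair U) : U := p.1.1

/-- The receiving user of a pair. -/
abbrev UserPair.dst {U : Type} (p : UserPair U) : U := p.1.2

section Model

variable {U : Type}

/-- What the modem at user `i` emits at one time: a reproduction letter `y_ji` for every pair
`(j, i)`, and a medium input letter `ι_i`. -/
abbrev ModemOut (𝒴 : UserPair U → Type) (I : U → Type) (i : U) :=
  (∀ p : {p : UserPair U // p.dst = i}, 𝒴 p.1) × I i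

/-- All signals in the network at one time: the emissions of all modems and the medium outputs
`o_i` at all users. -/
abbrev Signal (𝒴 : UserPair U → Type) (I O : U → Type) :=
  (∀ i, ModemOut 𝒴 I i) × (∀ i, O i)

/-- What the modem at user `i` knows when it emits its letters of time `k + 1`:
* for the pairs `(i, j) ∈ A`, the data `In` to be conveyed (a source block or a message);
* for the pairs `(i, j) ∉ A`, the source letters `x_ij(t)`, `-∞ < t ≤ k`;
* the common randomness `c`;
* the medium outputs `o_i(t)`, `1 ≤ t ≤ k`;
* its own past reproductions `y_ji(t)` and medium inputs `ι_i(t)`, `1 ≤ t ≤ k`.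

The index `j : Fin k` stands for the time `j + 1`.

The data of a pair in `A` are handed over before the first use of the medium, that is, the block
occupies the times `-n+1, …, 0` (delays of the pairs in `A` are immaterial). A modem which uses the
letters of a block one at a time, as they become available, is a special case. -/
abbrev ModemView (A : Finset (UserPair U)) (In : A → Type) (𝒳 𝒴 : UserPair U → Type)
    (I O : U → Type) (C : Type) (i : U) (k : ℕ) :=
  (∀ p : {p : A // p.1.src = i}, In p.1) ×
  (∀ p : {p : {p : UserPair U // p ∉ A} // p.1.src = i}, Set.Iic (k : ℤ) → 𝒳 p.1.1) ×
  C × (Fin k → O i) × (Fin k → ModemOut 𝒴 I i)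

section Modem

variable (A : Finset (UserPair U)) (In Out : A → Type) (𝒳 𝒴 : UserPair U → Type)
  (I O : U → Type) (C : Type)
  [∀ p, MeasurableSpace (In p)] [∀ p, MeasurableSpace (Out p)]
  [∀ p, MeasurableSpace (𝒳 p)] [∀ p, MeasurableSpace (𝒴 p)]
  [∀ i, MeasurableSpace (I i)] [∀ i, MeasurableSpace (O i)] [MeasurableSpace C]

/-- A modem at user `i`: at every time a transition probability from what user `i` knows to what
it emits and, for every pair `(j, i) ∈ A`, a map which forms the final decoding of the data of that
pair from the reproduction process `y_ji(·)` and the common randomness. Decoding need not be causal.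
The plain readout `y_ji[k] = y_ji(t_k)` at prescribed times `t_k` is a special case. -/
structure Modem (i : U) where
  /-- The transition probability for the emissions of time `k + 1`. -/
  step : ∀ k : ℕ, Kernel (ModemView A In 𝒳 𝒴 I O C i k) (ModemOut 𝒴 I i)
  markov : ∀ k, IsMarkovKernel (step k)
  /-- The final decoding for a pair of `A` which ends at `i`. -/
  read : ∀ p : {p : A // p.1.dst = i}, (ℕ → 𝒴 p.1.1) × C → Out p.1
  measurable_read : ∀ p, Measurable (read p)

/-- The medium, with a random initial state in `S`: at every time a transition probability for the
outputs `o_i(k + 1)` at all users, given the initial state, all inputs `ι_i(t)` and all outputs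
`o_i(t)`, `1 ≤ t ≤ k`. -/
structure Medium (S : Type) [MeasurableSpace S] where
  /-- The law of the initial state. -/
  init : Measure S
  isProbabilityMeasure_init : IsProbabilityMeasure init
  /-- The transition probability for the outputs of time `k + 1`. -/
  step : ∀ k : ℕ, Kernel (S × (Fin k → ∀ i, I i) × (Fin k → ∀ i, O i)) (∀ i, O i)
  markov : ∀ k, IsMarkovKernel (step k)

end Modem

attribute [instance] Modem.markov Medium.isProbabilityMeasure_init Medium.markov

/-- The separation architecture `dec ∘ g ∘ enc` at user `i`: the data to be sent are first encoded
into messages by `enc`, the modem `g` communicates messages, and the messages decoded by `g` are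
finally decoded by `dec`. -/
noncomputable def Modem.withSourceCode {A : Finset (UserPair U)} {In Out Msg : A → Type}
    {𝒳 𝒴 : UserPair U → Type} {I O : U → Type} {C : Type}
    [∀ p, MeasurableSpace (In p)] [∀ p, DiscreteMeasurableSpace (In p)]
    [∀ p, MeasurableSpace (Out p)]
    [∀ p, MeasurableSpace (Msg p)] [∀ p, DiscreteMeasurableSpace (Msg p)]
    [∀ p, MeasurableSpace (𝒳 p)] [∀ p, MeasurableSpace (𝒴 p)]
    [∀ i, MeasurableSpace (I i)] [∀ i, MeasurableSpace (O i)] [MeasurableSpace C] {i : U}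
    (g : Modem A Msg Msg 𝒳 𝒴 I O C i)
    (enc : ∀ p, In p → Msg p) (dec : ∀ p, Msg p → Out p) : Modem A In Out 𝒳 𝒴 I O C i where
  step k := (g.step k).comap (fun v => (fun p => enc p.1 (v.1 p), v.2))
    ((measurable_pi_lambda _ fun p =>
      (Measurable.of_discrete (f := enc p.1)).comp
        ((measurable_pi_apply p).comp measurable_fst)).prodMk measurable_snd)
  markov _ := inferInstance
  read p w := dec p.1 (g.read p w)
  measurable_read p := Measurable.of_discrete.comp (g.measurable_read p)

/-! ### The law of the interconnected system -/

/-- The primitive variables: the data of the pairs in `A`, the other sources (processes over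
`-∞ < t < ∞`), the common randomness, and the initial state of the medium. -/
abbrev Primitive (A : Finset (UserPair U)) (In : A → Type) (𝒳 : UserPair U → Type)
    (C S : Type) :=
  (∀ p, In p) × (∀ p : {p : UserPair U // p ∉ A}, ℤ → 𝒳 p.1) × C × S

lemma measurable_pi_measure {ι α : Type} [Fintype ι] {β : ι → Type} [MeasurableSpace α]
    [∀ i, MeasurableSpace (β i)] (κ : ∀ i, Kernel α (β i)) [∀ i, IsMarkovKernel (κ i)] :
    Measurable fun a => Measure.pi fun i => κ i a := by
  refine Measurable.measure_of_isPiSystem_of_isProbabilityMeasure generateFrom_pi.symm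
    isPiSystem_pi ?_
  rintro _ ⟨s, hs, rfl⟩
  simp only [Set.mem_pi, Set.mem_univ, true_implies, Set.mem_ofPred_eq] at hs
  simp only [Measure.pi_pi]
  exact Finset.measurable_prod _ fun i _ => Kernel.measurable_coe (κ i) (hs i)

/-- The independent product of finitely many transition probabilities. -/
noncomputable def piKernel {ι α : Type} [Fintype ι] {β : ι → Type} [MeasurableSpace α]
    [∀ i, MeasurableSpace (β i)] (κ : ∀ i, Kernel α (β i)) [∀ i, IsMarkovKernel (κ i)] :
    Kernel α (∀ i, β i) where
  toFun a := Measure.pi fun i => κ i a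
  measurable' := measurable_pi_measure κ

instance {ι α : Type} [Fintype ι] {β : ι → Type} [MeasurableSpace α]
    [∀ i, MeasurableSpace (β i)] (κ : ∀ i, Kernel α (β i)) [∀ i, IsMarkovKernel (κ i)] :
    IsMarkovKernel (piKernel κ) :=
  ⟨fun a => inferInstanceAs (IsProbabilityMeasure (Measure.pi fun i => κ i a))⟩

section Run

variable {P Sig : Type}

/-- Stage `0` holds the primitive variables, stage `t ≥ 1` the signals of time `t`. -/
def Stage (P Sig : Type) : ℕ → Type
  | 0 => P
  | _ + 1 => Sig

/-- The primitive variables and the signals of the times `1, …, k`, read off the stages `0, …, k`. -/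
def unpack {k : ℕ} (w : ∀ j : Finset.Iic k, Stage P Sig j) : P × (Fin k → Sig) :=
  (w ⟨0, by simp⟩, fun j => w ⟨j.1 + 1, by simp⟩)

variable [MeasurableSpace P] [MeasurableSpace Sig]

instance : ∀ t, MeasurableSpace (Stage P Sig t)
  | 0 => inferInstanceAs (MeasurableSpace P)
  | _ + 1 => inferInstanceAs (MeasurableSpace Sig)

lemma measurable_unpack (k : ℕ) : Measurable (unpack (P := P) (Sig := Sig) (k := k)) :=
  (measurable_pi_apply (⟨0, by simp⟩ : Finset.Iic k)).prodMk
    (measurable_pi_lambda _ fun j =>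
      measurable_pi_apply (⟨j.1 + 1, by simp⟩ : Finset.Iic k))

/-- A transition probability for the signals of time `k + 1`, in terms of stages. -/
noncomputable def stageKernel {k : ℕ} (κ : Kernel (P × (Fin k → Sig)) Sig) :
    Kernel (∀ j : Finset.Iic k, Stage P Sig j) (Stage P Sig (k + 1)) :=
  κ.comap unpack (measurable_unpack k)

instance {k : ℕ} (κ : Kernel (P × (Fin k → Sig)) Sig) [IsMarkovKernel κ] :
    IsMarkovKernel (stageKernel κ) :=
  inferInstanceAs (IsMarkovKernel (κ.comap unpack (measurable_unpack k)))

/-- The primitive variables as stage `0`. -/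
def initialStage (x : P) : ∀ j : Finset.Iic 0, Stage P Sig j
  | ⟨0, _⟩ => x
  | ⟨_ + 1, h⟩ => absurd h (by simp)

lemma measurable_initialStage : Measurable (initialStage (P := P) (Sig := Sig)) :=
  measurable_pi_lambda _ fun j => match j with
    | ⟨0, _⟩ => measurable_id
    | ⟨_ + 1, h⟩ => absurd h (by simp)

/-- The signals of the times `1, 2, …`, that is, all stages but the initial one. -/
def signalStages (w : ∀ t, Stage P Sig t) : ℕ → Sig := fun k => w (k + 1)

lemma measurable_signalStages : Measurable (signalStages (P := P) (Sig := Sig)) :=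
  measurable_pi_lambda _ fun k => measurable_pi_apply (k + 1)

/-- The law of the whole signal process (index `k` stands for time `k + 1`) as a transition
probability from the primitive variables, when the signals of time `k + 1` are produced by `κ k`
from the primitive variables and the signals of the times `1, …, k` (Ionescu-Tulcea). -/
noncomputable def run (κ : ∀ k : ℕ, Kernel (P × (Fin k → Sig)) Sig) [∀ k, IsMarkovKernel (κ k)] :
    Kernel P (ℕ → Sig) :=
  ((Kernel.traj (fun k => stageKernel (κ k)) 0).map signalStages).comap initialStage
    measurable_initialStage

instance (κ : ∀ k : ℕ, Kernel (P × (Fin k → Sig)) Sig) [∀ k, IsMarkovKernel (κ k)] :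
    IsMarkovKernel (run κ) :=
  have := Kernel.IsMarkovKernel.map (Kernel.traj (fun k => stageKernel (κ k)) 0)
    (measurable_signalStages (P := P) (Sig := Sig))
  inferInstanceAs (IsMarkovKernel (Kernel.comap _ _ measurable_initialStage))

end Run

section System

variable {A : Finset (UserPair U)} {In Out : A → Type}
  {𝒳 𝒴 : UserPair U → Type} {I O : U → Type} {C S : Type}
  [∀ p, MeasurableSpace (In p)] [∀ p, MeasurableSpace (Out p)]
  [∀ p, MeasurableSpace (𝒳 p)] [∀ p, MeasurableSpace (𝒴 p)]
  [∀ i, MeasurableSpace (I i)] [∀ i, MeasurableSpace (O i)] [MeasurableSpace C]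
  [MeasurableSpace S]

/-- The part of the primitive variables and of the past signals which user `i` knows. -/
def localView (i : U) (k : ℕ) (w : Primitive A In 𝒳 C S × (Fin k → Signal 𝒴 I O)) :
    ModemView A In 𝒳 𝒴 I O C i k :=
  (fun p => w.1.1 p.1, fun p t => w.1.2.1 p.1 t, w.1.2.2.1, fun t => (w.2 t).2 i,
    fun t => (w.2 t).1 i)

lemma measurable_localView (i : U) (k : ℕ) : Measurable
    (localView (A := A) (In := In) (𝒳 := 𝒳) (𝒴 := 𝒴) (I := I) (O := O) (C := C) (S := S) i k) := by
  unfold localView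
  fun_prop

lemma measurable_mediumView (k : ℕ) : Measurable
    (fun w : Primitive A In 𝒳 C S × (Fin k → Signal 𝒴 I O) =>
      (w.1.2.2.2, (fun t i => ((w.2 t).1 i).2), fun t => (w.2 t).2)) := by
  fun_prop

variable [Fintype U]

/-- Interconnection of the modems `h i` and the medium `m`: given the past, the modems and the
medium produce their outputs of time `k + 1` independently of each other. -/
noncomputable def systemStep (h : ∀ i, Modem A In Out 𝒳 𝒴 I O C i) (m : Medium I O S) (k : ℕ) :
    Kernel (Primitive A In 𝒳 C S × (Fin k → Signal 𝒴 I O)) (Signal 𝒴 I O) :=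
  (piKernel fun i => ((h i).step k).comap (localView i k) (measurable_localView i k)) ×ₖ
    (m.step k).comap _ (measurable_mediumView k)

instance (h : ∀ i, Modem A In Out 𝒳 𝒴 I O C i) (m : Medium I O S) (k : ℕ) :
    IsMarkovKernel (systemStep h m k) := by
  unfold systemStep; infer_instance

/-- A realization of the primitive variables and of the signals of all times. -/
abbrev Realization (A : Finset (UserPair U)) (In : A → Type) (𝒳 𝒴 : UserPair U → Type)
    (I O : U → Type) (C S : Type) :=
  Primitive A In 𝒳 C S × (ℕ → Signal 𝒴 I O)

variable [DecidableEq U]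

/-- The joint law of all variables, when the data of the pairs in `A` have law `β`, the sources
`X_ij`, `(i, j) ∉ A`, have laws `ν`, the common randomness has law `κ`, and all these and the initial
state of the medium are independent of each other. -/
noncomputable def systemLaw (h : ∀ i, Modem A In Out 𝒳 𝒴 I O C i) (m : Medium I O S)
    (β : Measure (∀ p, In p)) (ν : ∀ p : {p : UserPair U // p ∉ A}, Measure (ℤ → 𝒳 p.1))
    (κ : Measure C) : Measure (Realization A In 𝒳 𝒴 I O C S) :=
  (β.prod ((Measure.pi ν).prod (κ.prod m.init))) ⊗ₘ run (systemStep h m)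

/-- The reproduction process `y_p(·)` of the pair `p`, as emitted by the modem at its receiver. -/
def reproduction (p : UserPair U) (w : Realization A In 𝒳 𝒴 I O C S) : ℕ → 𝒴 p :=
  fun k => ((w.2 k).1 p.dst).1 ⟨p, rfl⟩

/-- The final decoding of the data of a pair `p ∈ A` at its receiver. -/
def decoded (h : ∀ i, Modem A In Out 𝒳 𝒴 I O C i) (p : A)
    (w : Realization A In 𝒳 𝒴 I O C S) : Out p :=
  (h p.1.dst).read ⟨p, rfl⟩ (reproduction p.1 w, w.1.2.2.1)

/-- The medium input process at user `i`. -/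
def mediumInput (i : U) (w : Realization A In 𝒳 𝒴 I O C S) : ℕ → I i :=
  fun k => ((w.2 k).1 i).2

/-- The medium output process at user `i`. -/
def mediumOutput (i : U) (w : Realization A In 𝒳 𝒴 I O C S) : ℕ → O i :=
  fun k => (w.2 k).2 i

/-- All sources `X_ij`, `(i, j) ∉ A`, with their reproduction processes `Y_ij`, together with the
medium inputs and medium outputs of all users. -/
def unaffected (w : Realization A In 𝒳 𝒴 I O C S) :
    (∀ p : {p : UserPair U // p ∉ A}, (ℤ → 𝒳 p.1) × (ℕ → 𝒴 p.1)) ×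
      (∀ i, (ℕ → I i) × (ℕ → O i)) :=
  (fun p => (w.1.2.1 p, reproduction p.1 w), fun i => (mediumInput i w, mediumOutput i w))

end System

/-! ### Communication of sources and messages -/

section Communication

variable [Fintype U] [DecidableEq U] {A : Finset (UserPair U)}
  {𝒳 𝒴 : UserPair U → Type} {I O : U → Type} {C : ℕ → Type} {S : Type}
  [∀ p, MeasurableSpace (𝒳 p)] [∀ p, MeasurableSpace (𝒴 p)]
  [∀ i, MeasurableSpace (I i)] [∀ i, MeasurableSpace (O i)] [∀ n, MeasurableSpace (C n)]
  [MeasurableSpace S]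

/-- Modem at user `i` for block length `n`, which communicates source blocks `x_p^n`, `p ∈ A`. -/
abbrev SourceModem (A : Finset (UserPair U)) (𝒳 𝒴 : UserPair U → Type) (I O : U → Type) (C : Type)
    [∀ p, MeasurableSpace (𝒳 p)] [∀ p, MeasurableSpace (𝒴 p)]
    [∀ i, MeasurableSpace (I i)] [∀ i, MeasurableSpace (O i)] [MeasurableSpace C] (n : ℕ) (i : U) :=
  Modem A (fun p => Fin n → 𝒳 p.1) (fun p => Fin n → 𝒴 p.1) 𝒳 𝒴 I O C i

/-- Modem at user `i` which communicates messages from sets of `M p` elements, `p ∈ A`. -/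
abbrev MessageModem (A : Finset (UserPair U)) (𝒳 𝒴 : UserPair U → Type) (I O : U → Type) (C : Type)
    [∀ p, MeasurableSpace (𝒳 p)] [∀ p, MeasurableSpace (𝒴 p)]
    [∀ i, MeasurableSpace (I i)] [∀ i, MeasurableSpace (O i)] [MeasurableSpace C]
    (M : A → ℕ) (i : U) :=
  Modem A (fun p => Fin (M p)) (fun p => Fin (M p)) 𝒳 𝒴 I O C i

/-- The joint law of the system of block length `n` when, for `p ∈ A`, the source `X_p` is i.i.d.
with marginal `μ p`. -/
noncomputable def sourceLaw {C : Type} [MeasurableSpace C] {n : ℕ}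
    (h : ∀ i, SourceModem A 𝒳 𝒴 I O C n i) (m : Medium I O S)
    (μ : ∀ p : A, Measure (𝒳 p.1)) (ν : ∀ p : {p : UserPair U // p ∉ A}, Measure (ℤ → 𝒳 p.1))
    (κ : Measure C) : Measure (Realization A (fun p => Fin n → 𝒳 p.1) 𝒳 𝒴 I O C S) :=
  systemLaw h m (Measure.pi fun p => Measure.pi fun _ : Fin n => μ p) ν κ

/-- The source `X_p`, `p ∈ A`, is communicated to within distortion `D`: the probability of excess
distortion tends to `0` as the block length tends to infinity. -/
def CommunicatesWithin (h : ∀ n i, SourceModem A 𝒳 𝒴 I O (C n) n i) (m : Medium I O S)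
    (μ : ∀ p : A, Measure (𝒳 p.1)) (ν : ∀ p : {p : UserPair U // p ∉ A}, Measure (ℤ → 𝒳 p.1))
    (κ : ∀ n, Measure (C n)) (p : A) (d : 𝒳 p.1 → 𝒴 p.1 → ℝ≥0) (D : ℝ) : Prop :=
  Tendsto (fun n => sourceLaw (h n) m μ ν (κ n)
    {w | D < avgDistortion d (w.1.1 p) (decoded (h n) p w)}) atTop (𝓝 0)

/-- Reliable communication of messages under the maximal block error probability criterion: the
probability that the message of the pair `p ∈ A` is decoded wrongly, maximized over that message
(and over the messages of all other pairs), tends to `0` as the block length tends to infinity. -/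
def CommunicatesReliably {M : ℕ → A → ℕ} (g : ∀ n i, MessageModem A 𝒳 𝒴 I O (C n) (M n) i)
    (m : Medium I O S) (ν : ∀ p : {p : UserPair U // p ∉ A}, Measure (ℤ → 𝒳 p.1))
    (κ : ∀ n, Measure (C n)) (p : A) : Prop :=
  Tendsto (fun n => ⨆ msg : ∀ q, Fin (M n q),
    systemLaw (g n) m (Measure.dirac msg) ν (κ n) {w | decoded (g n) p w ≠ msg p}) atTop (𝓝 0)

end Communication
end Model
end UnknownNetwork

open UnknownNetwork

/-! The source itself supplies a good random codebook. For every message an independent codeword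
with the law of the source block is drawn; all users know the codebooks (the additional common
randomness), and the codeword of the message is fed to the old modem `h`. Whatever the messages, the
codewords sent have exactly the joint law of the source blocks (`map_systemLaw_withCodebook`), so
old modems, medium and other sources behave in law as before, over every medium. This gives the
invariance claims at once, and it shows that the sent codeword is within distortion D of the output
with probability tending to 1.

The decoder looks for a typical codeword within D of the output. The codeword of another message is
independent of the whole system, so the union bound `systemLaw_withCodebook_error_le` leaves
⌊2^(nR)⌋ times the largest probability, over fixed blocks y, that a typical source block falls
within D of y. As the average is over codebooks, which are part of the common randomness, the bound
holds for each message vector separately and no expurgation is needed. Composing with a source code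
of rate R > R(D') gives distortion D' end to end.

The core is `exists_packing`: for R < R(D) the product above tends to 0. Since R(D) is defined
through codes, the argument is a duality of packing and covering. Take R < R' < R₁ < R(D) and
suppose that, for a single length m, some y is matched by typical blocks with probability above
2^(-mR'). Repetition gives such popular blocks of all lengths (`HasPopularBlock.extend`). The
product law is invariant under permutations of the positions, so about 2^(nR') permuted copies reach
every typical block with distortion slightly above D (`HasPopularBlock.exists_cover`). Enlarging
each codeword to a small Hamming ball removes the excess at a small cost in rate
(`exists_codebook`). Then R₁ would be achievable, a contradiction. -/

namespace UnknownNetwork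

/-! ### Change of the primitive variables -/

section RunComap

variable {P P' Sig : Type}

/-- A map of the primitive variables, extended by the identity of the signals. -/
def stageMap (φ : P → P') : ∀ t, Stage P Sig t → Stage P' Sig t
  | 0 => φ
  | _ + 1 => id

variable [MeasurableSpace P] [MeasurableSpace P'] [MeasurableSpace Sig]

lemma measurable_stageMap {φ : P → P'} (hφ : Measurable φ) :
    ∀ t, Measurable (stageMap (Sig := Sig) φ t)
  | 0 => hφ
  | _ + 1 => measurable_id

lemma measurable_stageMap_pi {φ : P → P'} (hφ : Measurable φ) (b : ℕ) :
    Measurable fun (u : ∀ j : Finset.Iic b, Stage P Sig j) (j : Finset.Iic b) =>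
      stageMap φ j (u j) :=
  measurable_pi_lambda _ fun j => (measurable_stageMap hφ j).comp (measurable_pi_apply j)

lemma partialTraj_succ_self_apply {X : ℕ → Type} [∀ n, MeasurableSpace (X n)]
    (κ : ∀ n, Kernel (∀ i : Finset.Iic n, X i) (X (n + 1))) [∀ n, IsMarkovKernel (κ n)] (b : ℕ)
    (u : ∀ i : Finset.Iic b, X i) :
    Kernel.partialTraj κ b (b + 1) u =
      (κ b u).map fun v => IicProdIoc b (b + 1) (u, MeasurableEquiv.piSingleton b v) := by
  rw [Kernel.partialTraj_succ_self, Kernel.map_apply _ (by fun_prop), Kernel.prod_apply,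
    Kernel.id_apply, Kernel.map_apply _ (by fun_prop), Measure.dirac_prod,
    Measure.map_map (by fun_prop) (by fun_prop), Measure.map_map (by fun_prop) (by fun_prop)]
  rfl

/-- Induction on the time: each step only appends a signal, on which `stageMap` is the identity, and
its law sees the primitive variables through `φ` alone. -/
lemma map_partialTraj_stageMap {φ : P → P'} (hφ : Measurable φ)
    (κ : ∀ k : ℕ, Kernel (P × (Fin k → Sig)) Sig) [∀ k, IsMarkovKernel (κ k)]
    (κ' : ∀ k : ℕ, Kernel (P' × (Fin k → Sig)) Sig) [∀ k, IsMarkovKernel (κ' k)]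
    (hκ : ∀ k x s, κ k (x, s) = κ' k (φ x, s)) (b : ℕ)
    (u : ∀ j : Finset.Iic 0, Stage P Sig j) :
    (Kernel.partialTraj (fun k => stageKernel (κ k)) 0 b u).map
      (fun w (j : Finset.Iic b) => stageMap φ j (w j)) =
      Kernel.partialTraj (fun k => stageKernel (κ' k)) 0 b (fun j => stageMap φ j (u j)) := by
  induction b with
  | zero =>
    simp only [Kernel.partialTraj_self, Kernel.id_apply]
    exact Measure.map_dirac' (measurable_stageMap_pi hφ 0) u
  | succ b ih =>
    rw [Kernel.partialTraj_succ_eq_comp (Nat.zero_le b),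
      Kernel.partialTraj_succ_eq_comp (Nat.zero_le b), Kernel.comp_apply, Kernel.comp_apply, ← ih]
    ext s hs
    have hm := measurable_stageMap_pi (Sig := Sig) hφ
    rw [Measure.map_apply (hm _) hs, Measure.bind_apply (hm _ hs) (Kernel.aemeasurable _),
      Measure.bind_apply hs (Kernel.aemeasurable _),
      lintegral_map (Kernel.measurable_coe _ hs) (hm _)]
    refine lintegral_congr fun v => ?_
    rw [← Measure.map_apply (hm _) hs]
    congr 1
    rw [partialTraj_succ_self_apply, partialTraj_succ_self_apply, Measure.map_map (hm _)
      (by fun_prop)]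
    have h1 : stageKernel (κ b) v = stageKernel (κ' b) (fun j => stageMap φ j (v j)) := by
      simp only [stageKernel]
      exact hκ b _ _
    rw [h1]
    congr 1
    funext z
    funext j
    simp only [Function.comp, IicProdIoc]
    split_ifs with hj
    · rfl
    · obtain ⟨j, hj'⟩ := j
      have : j = b + 1 := by
        simp at hj hj'; omega
      subst this
      rfl

/-- Uniqueness of projective limits reduces this to finite horizons. It is the tool which identifies
a system with coded data with a system fed by the code outputs. -/
lemma run_apply_of_comap {φ : P → P'} (hφ : Measurable φ)
    (κ : ∀ k : ℕ, Kernel (P × (Fin k → Sig)) Sig) [∀ k, IsMarkovKernel (κ k)]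
    (κ' : ∀ k : ℕ, Kernel (P' × (Fin k → Sig)) Sig) [∀ k, IsMarkovKernel (κ' k)]
    (hκ : ∀ k x s, κ k (x, s) = κ' k (φ x, s)) (x : P) :
    run κ x = run κ' (φ x) := by
  have hm : Measurable fun (w : ∀ t, Stage P Sig t) t => stageMap φ t (w t) :=
    measurable_pi_lambda _ fun j => (measurable_stageMap hφ j).comp (measurable_pi_apply j)
  have key : (Kernel.traj (fun k => stageKernel (κ k)) 0 (initialStage x)).map
      (fun w t => stageMap φ t (w t)) =
      Kernel.traj (fun k => stageKernel (κ' k)) 0 (initialStage (φ x)) := by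
    refine ((Kernel.isProjectiveLimit_trajFun (fun k => stageKernel (κ' k)) 0 _).unique ?_).symm
    rw [isProjectiveLimit_nat_iff (Kernel.isProjectiveMeasureFamily_partialTraj _ _)]
    intro k
    rw [inducedFamily_Iic, Measure.map_map (by fun_prop) hm]
    have h2 : initialStage (Sig := Sig) (φ x) =
        fun j : Finset.Iic 0 => stageMap φ j (initialStage x j) := by
      funext j
      match j with
      | ⟨0, _⟩ => rfl
      | ⟨_ + 1, h⟩ => exact absurd h (by simp)
    rw [h2, ← map_partialTraj_stageMap hφ κ κ' hκ, ← Kernel.traj_map_frestrictLe_apply,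
      Measure.map_map (measurable_stageMap_pi hφ k) (by fun_prop)]
    rfl
  simp only [run, Kernel.comap_apply]
  rw [Kernel.map_apply _ measurable_signalStages, Kernel.map_apply _ measurable_signalStages, ← key,
    Measure.map_map measurable_signalStages hm]
  rfl

end RunComap

/-! ### Combinatorics of blocks -/

section Blocks

variable {X Y : Type} {ι : Type} [Fintype ι]

/-- The number of positions at which two blocks differ. -/
def mismatch [DecidableEq X] (x y : ι → X) : ℕ := (Finset.univ.filter fun k => x k ≠ y k).card

/-- The number of occurrences of a letter in a block. -/
def occurrences [DecidableEq X] (x : ι → X) (a : X) : ℕ := (Finset.univ.filter fun k => x k = a).card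

lemma occurrences_comp_perm [DecidableEq X] (x : ι → X) (π : Equiv.Perm ι) (a : X) :
    occurrences (x ∘ π) a = occurrences x a := by
  unfold occurrences
  exact Finset.card_equiv π (by simp)

lemma occurrences_append [DecidableEq X] {m n : ℕ} (u : Fin m → X) (v : Fin n → X) (a : X) :
    occurrences (Fin.append u v) a = occurrences u a + occurrences v a := by
  simp only [occurrences, Finset.card_filter]
  rw [Fin.sum_univ_add]
  simp

lemma occurrences_le [DecidableEq X] {n : ℕ} (x : Fin n → X) (a : X) : occurrences x a ≤ n := by
  simpa [occurrences] using Finset.card_filter_le (Finset.univ : Finset (Fin n)) fun k => x k = a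

/-- A permutation matches the letters of two blocks, up to the difference of the counts. -/
lemma exists_perm_mismatch_le [DecidableEq X] [Fintype X] [DecidableEq ι] (x z : ι → X) :
    ∃ σ : Equiv.Perm ι,
      mismatch (x ∘ σ) z ≤ ∑ a, (occurrences z a - occurrences x a) := by
  -- A permutation with the fewest mismatches will do: any waste could be removed by one
  -- transposition.
  obtain ⟨σ, -, hσ⟩ := Finset.exists_min_image (Finset.univ : Finset (Equiv.Perm ι))
    (fun σ => mismatch (x ∘ σ) z) Finset.univ_nonempty
  refine ⟨σ, ?_⟩
  have hfib : mismatch (x ∘ σ) z =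
      ∑ a, (Finset.univ.filter fun k => x (σ k) ≠ z k ∧ z k = a).card := by
    unfold mismatch
    rw [Finset.card_eq_sum_card_fiberwise (f := z) (t := Finset.univ) (by simp)]
    refine Finset.sum_congr rfl fun a _ => ?_
    rw [Finset.filter_filter]; rfl
  rw [hfib]
  refine Finset.sum_le_sum fun a _ => ?_
  by_cases he : (Finset.univ.filter fun k => x (σ k) ≠ z k ∧ z k = a) = ∅
  · rw [he]; simp
  obtain ⟨k, hk⟩ := Finset.nonempty_iff_ne_empty.2 he
  simp only [Finset.mem_filter, Finset.mem_univ, true_and] at hk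
  -- If `z` still lacks the letter `a` at `k`, every `a` of `x ∘ σ` is already well placed;
  -- otherwise swapping `k` and `l` repairs `k` without new mismatches. So the mismatches in the
  -- fibre of `a` are exactly the surplus of `a` in `z`.
  have hno : ∀ l, x (σ l) = a → z l = a := by
    intro l hl
    by_contra hne
    have hlk : l ≠ k := fun h => hk.1 (by rw [← h, hl, h, hk.2])
    have hmin := hσ (σ * Equiv.swap k l) (Finset.mem_univ _)
    refine absurd hmin (not_le.2 ?_)
    unfold mismatch
    refine Finset.card_lt_card ?_
    rw [Finset.ssubset_iff_of_subset]
    · refine ⟨k, by simpa using hk.1, ?_⟩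
      exact fun hmem => (Finset.mem_filter.1 hmem).2 (by simp [hl, hk.2])
    · intro j hj
      refine Finset.mem_filter.2 ⟨Finset.mem_univ _, ?_⟩
      replace hj : x (σ (Equiv.swap k l j)) ≠ z j := (Finset.mem_filter.1 hj).2
      change x (σ j) ≠ z j
      by_cases h1 : j = k
      · subst h1; exact hk.1
      by_cases h2 : j = l
      · subst h2
        rw [hl]; exact fun h => hne h.symm
      · rwa [Equiv.swap_apply_of_ne_of_ne h1 h2] at hj
  have hcard : occurrences x a = (Finset.univ.filter fun k => x (σ k) = a).card :=
    (occurrences_comp_perm x σ a).symm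
  have hsplit : occurrences z a = (Finset.univ.filter fun k => x (σ k) ≠ z k ∧ z k = a).card +
      (Finset.univ.filter fun k => x (σ k) = a).card := by
    unfold occurrences
    rw [← Finset.card_union_of_disjoint]
    · congr 1
      ext j
      simp only [Finset.mem_filter, Finset.mem_univ, true_and, Finset.mem_union]
      constructor
      · intro h
        by_cases h' : x (σ j) = a
        · exact Or.inr h'
        · exact Or.inl ⟨by rwa [h], h⟩
      · rintro (h | h)
        · exact h.2
        · exact hno j h
    · rw [Finset.disjoint_left]
      intro j hj hj'
      simp only [Finset.mem_filter, Finset.mem_univ, true_and] at hj hj'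
      exact hj.1 (hj'.trans hj.2.symm)
  omega

/-- Greedy covering: if every point is covered by a fraction `ρ` of the sets, few sets cover. -/
lemma exists_small_cover {α β : Type} [DecidableEq α] [Fintype β] [Nonempty β] (r : α → β → Prop)
    [∀ a b, Decidable (r a b)] (S : Finset α) {ρ : ℝ} (hρ1 : ρ ≤ 1)
    (h : ∀ a ∈ S, ρ * Fintype.card β ≤ ((Finset.univ.filter fun b => r a b).card : ℝ)) (K : ℕ) :
    ∃ B : Fin K → β, ((S.filter fun a => ∀ i, ¬ r a (B i)).card : ℝ) ≤ (1 - ρ) ^ K * S.card := by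
  induction K with
  | zero => exact ⟨Fin.elim0, by simp [Finset.filter_true_of_mem]⟩
  | succ K ih =>
    obtain ⟨B, hB⟩ := ih
    set S' := S.filter fun a => ∀ i, ¬ r a (B i) with hS'
    have hβ : (0 : ℝ) < Fintype.card β := by exact_mod_cast Fintype.card_pos
    -- Double counting: on average a set covers a fraction `ρ` of the points still uncovered, so
    -- some set does.
    obtain ⟨b, hb⟩ : ∃ b, ρ * S'.card ≤ ((S'.filter fun a => r a b).card : ℝ) := by
      by_contra hcon
      push Not at hcon
      have h1 : ∑ b : β, ((S'.filter fun a => r a b).card : ℝ) < ∑ _b : β, ρ * S'.card :=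
        Finset.sum_lt_sum_of_nonempty Finset.univ_nonempty fun b _ => hcon b
      have h2 : ∑ b : β, (S'.filter fun a => r a b).card =
          ∑ a ∈ S', (Finset.univ.filter fun b => r a b).card :=
        (Finset.sum_card_bipartiteAbove_eq_sum_card_bipartiteBelow r).symm
      have h3 : ∑ _a ∈ S', ρ * Fintype.card β ≤
          ∑ a ∈ S', ((Finset.univ.filter fun b => r a b).card : ℝ) :=
        Finset.sum_le_sum fun a ha => h a (Finset.mem_of_mem_filter a ha)
      have h2' := congrArg (Nat.cast : ℕ → ℝ) h2
      push_cast at h2'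
      simp only [Finset.sum_const, nsmul_eq_mul, Finset.card_univ] at h1 h3
      linarith
    refine ⟨Fin.cons b B, ?_⟩
    have hsub : (S.filter fun a => ∀ i, ¬ r a ((Fin.cons b B : Fin (K + 1) → β) i)) =
        S'.filter fun a => ¬ r a b := by
      ext a
      simp only [Finset.mem_filter, hS', Fin.forall_fin_succ, Fin.cons_zero, Fin.cons_succ]
      tauto
    rw [hsub]
    have h4 : ((S'.filter fun a => r a b).card : ℝ) + (S'.filter fun a => ¬ r a b).card = S'.card := by
      exact_mod_cast Finset.card_filter_add_card_filter_not (s := S') fun a => r a b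
    calc ((S'.filter fun a => ¬ r a b).card : ℝ) ≤ (1 - ρ) * S'.card := by linarith
      _ ≤ (1 - ρ) * ((1 - ρ) ^ K * S.card) := by
        exact mul_le_mul_of_nonneg_left hB (by linarith)
      _ = _ := by ring

/-- The volume of a Hamming ball. -/
lemma card_mismatch_le [DecidableEq Y] [Fintype Y] [DecidableEq ι] (y : ι → Y) (t : ℕ) {l : ℝ}
    (hl0 : 0 < l) (hl1 : l ≤ 1) :
    ((Finset.univ.filter fun y' : ι → Y => mismatch y' y ≤ t).card : ℝ) ≤
      l⁻¹ ^ t * (1 + Fintype.card Y * l) ^ Fintype.card ι := by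
  -- Chernoff bound: the weight `l ^ mismatch` factors over the positions, and is at least `l ^ t`
  -- on the ball.
  have h1 : ∑ y' : ι → Y, l ^ mismatch y' y ≤ (1 + Fintype.card Y * l) ^ Fintype.card ι := by
    have : ∀ y' : ι → Y, l ^ mismatch y' y = ∏ k, (if y' k ≠ y k then l else 1) := by
      intro y'
      rw [mismatch, ← Finset.prod_const, Finset.prod_filter]
    simp_rw [this]
    rw [← Fintype.prod_sum (fun k b => if b ≠ y k then l else (1 : ℝ)), ← Finset.card_univ (α := ι),
      ← Finset.prod_const]
    refine Finset.prod_le_prod (fun k _ => Finset.sum_nonneg fun b _ => by split_ifs <;> positivity)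
      fun k _ => ?_
    calc ∑ b, (if b ≠ y k then l else (1 : ℝ)) ≤ ∑ b, ((if b = y k then 1 else 0) + l) := by
          refine Finset.sum_le_sum fun b _ => ?_
          by_cases hb : b = y k
          · simp [hb, hl0.le]
          · simp [hb]
      _ = _ := by simp [Finset.sum_add_distrib]
  have h2 : ((Finset.univ.filter fun y' : ι → Y => mismatch y' y ≤ t).card : ℝ) * l ^ t ≤
      ∑ y' : ι → Y, l ^ mismatch y' y := by
    rw [← nsmul_eq_mul, ← Finset.sum_const]
    calc _ ≤ ∑ y' ∈ (Finset.univ.filter fun y' : ι → Y => mismatch y' y ≤ t), l ^ mismatch y' y := by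
          refine Finset.sum_le_sum fun y' hy' => ?_
          exact pow_le_pow_of_le_one hl0.le hl1 (Finset.mem_filter.1 hy').2
      _ ≤ _ := Finset.sum_le_sum_of_subset_of_nonneg (Finset.subset_univ _)
          fun _ _ _ => by positivity
  rw [inv_pow, inv_mul_eq_div, le_div_iff₀ (by positivity)]
  exact h2.trans h1

end Blocks

/-! ### Popular reproduction blocks and covering by their permutations -/

section Covering

variable {X Y : Type}

/-- Product weights are invariant under permutations, so the fraction of permutations taking a
random `z` into `E` has mean equal to the weight of `E`; some `z` attains the mean. -/
lemma exists_perm_average_le [Fintype X] [DecidableEq X] {ι : Type} [Fintype ι] [DecidableEq ι] {w : X → ℝ} (hw0 : ∀ a, 0 ≤ w a)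
    (hw1 : ∑ a, w a = 1) (E : Finset (ι → X)) :
    ∃ z : ι → X, (∑ x ∈ E, ∏ k, w (x k)) * Fintype.card (Equiv.Perm ι) ≤
      ((Finset.univ.filter fun π : Equiv.Perm ι => z ∘ π ∈ E).card : ℝ) := by
  by_contra hcon
  push Not at hcon
  set p := ∑ x ∈ E, ∏ k, w (x k) with hp
  have htot : ∑ z : ι → X, ∏ k, w (z k) = 1 := by
    rw [← Fintype.prod_sum (fun (_ : ι) a => w a)]; simp [hw1]
  have hinv : ∀ π : Equiv.Perm ι,
      ∑ z : ι → X, (∏ k, w (z k)) * (if z ∘ π ∈ E then 1 else 0) = p := by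
    intro π
    calc ∑ z : ι → X, (∏ k, w (z k)) * (if z ∘ π ∈ E then 1 else 0)
        = ∑ z : ι → X, (∏ k, w ((z ∘ π) k)) * (if z ∘ π ∈ E then 1 else 0) := by
          refine Finset.sum_congr rfl fun z _ => ?_
          rw [← Equiv.prod_comp π fun k => w (z k)]; rfl
      _ = ∑ x : ι → X, (∏ k, w (x k)) * (if x ∈ E then 1 else 0) :=
          Equiv.sum_comp (π.symm.arrowCongr (Equiv.refl X)) fun x : ι → X =>
            (∏ k, w (x k)) * (if x ∈ E then (1 : ℝ) else 0)
      _ = p := by simp [hp]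
  have hsum : ∑ z : ι → X, (∏ k, w (z k)) *
      ((Finset.univ.filter fun π : Equiv.Perm ι => z ∘ π ∈ E).card : ℝ) =
      p * Fintype.card (Equiv.Perm ι) := by
    simp_rw [Finset.card_filter, Nat.cast_sum, Finset.mul_sum]
    rw [Finset.sum_comm]
    push_cast
    simp_rw [hinv]
    simp [mul_comm]
  -- A weighted mean of positive deficits vanishes only if all weights vanish, but they sum to 1.
  have hz : ∀ z : ι → X, ∏ k, w (z k) = 0 := by
    have h0 : ∑ z : ι → X, (∏ k, w (z k)) * (p * Fintype.card (Equiv.Perm ι) -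
        ((Finset.univ.filter fun π : Equiv.Perm ι => z ∘ π ∈ E).card : ℝ)) = 0 := by
      simp_rw [mul_sub, Finset.sum_sub_distrib, hsum, ← Finset.sum_mul, htot]
      ring
    rw [Finset.sum_eq_zero_iff_of_nonneg] at h0
    · intro z
      rcases mul_eq_zero.1 (h0 z (Finset.mem_univ z)) with h | h
      · exact h
      · linarith [hcon z]
    · intro z _
      exact mul_nonneg (Finset.prod_nonneg fun k _ => hw0 _) (by linarith [hcon z])
  simp [hz] at htot

/-- There is a reproduction block `y` such that a set of probability at least `p` of source blocks,
whose letter frequencies are within `c` of the expected ones, is within distortion `B` of `y`. -/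
def HasPopularBlock [DecidableEq X] (w : X → ℝ) (d : X → Y → ℝ≥0) (n : ℕ) (p B c : ℝ) : Prop :=
  ∃ (E : Finset (Fin n → X)) (y : Fin n → Y), p ≤ ∑ x ∈ E, ∏ k, w (x k) ∧
    ∀ x ∈ E, ∑ k, (d (x k) (y k) : ℝ) ≤ B ∧ ∀ a, |(occurrences x a : ℝ) - n * w a| ≤ c

/-- Concatenate the reproduction blocks and take the product of the two sets: probabilities multiply
by independence, while distortions and frequency deviations add. -/
lemma HasPopularBlock.append [DecidableEq X] {w : X → ℝ} {d : X → Y → ℝ≥0} {m n : ℕ}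
    {p q B B' c c' : ℝ} (hp : 0 ≤ p) (hq : 0 ≤ q) (h : HasPopularBlock w d m p B c)
    (h' : HasPopularBlock w d n q B' c') :
    HasPopularBlock w d (m + n) (p * q) (B + B') (c + c') := by
  obtain ⟨E, y, hE, hx⟩ := h
  obtain ⟨E', y', hE', hx'⟩ := h'
  refine ⟨(E ×ˢ E').map (Fin.appendEquiv m n).toEmbedding, Fin.append y y', ?_, ?_⟩
  · rw [Finset.sum_map, Finset.sum_product]
    calc p * q ≤ (∑ x ∈ E, ∏ k, w (x k)) * ∑ x ∈ E', ∏ k, w (x k) :=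
          mul_le_mul hE hE' hq (hp.trans hE)
      _ = _ := by
        rw [Finset.sum_mul_sum]
        refine Finset.sum_congr rfl fun u _ => Finset.sum_congr rfl fun v _ => ?_
        rw [Fin.prod_univ_add]
        simp [Fin.appendEquiv]
  · intro x hxm
    obtain ⟨⟨u, v⟩, huv, rfl⟩ := Finset.mem_map.1 hxm
    obtain ⟨hu, hv⟩ := Finset.mem_product.1 huv
    constructor
    · rw [Fin.sum_univ_add]
      simpa [Fin.appendEquiv] using add_le_add (hx u hu).1 (hx' v hv).1
    · intro a
      change |(occurrences (Fin.append u v) a : ℝ) - _| ≤ _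
      rw [occurrences_append]
      push_cast
      calc |(occurrences u a : ℝ) + occurrences v a - (m + n) * w a|
          = |((occurrences u a : ℝ) - m * w a) + (occurrences v a - n * w a)| := by ring_nf
        _ ≤ _ := (abs_add_le _ _).trans (add_le_add ((hx u hu).2 a) ((hx' v hv).2 a))

/-- A crude filler for the remainder when the wanted length is not a multiple of `m`. -/
lemma hasPopularBlock_univ [Fintype X] [DecidableEq X] {w : X → ℝ} (hw0 : ∀ a, 0 ≤ w a) (hw1 : ∑ a, w a = 1)
    {d : X → Y → ℝ≥0} {L : ℝ} (hL : ∀ a b, (d a b : ℝ) ≤ L) [Nonempty Y] (n : ℕ) :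
    HasPopularBlock w d n 1 (n * L) n := by
  refine ⟨Finset.univ, fun _ => Classical.arbitrary Y, ?_, fun x _ => ⟨?_, fun a => ?_⟩⟩
  · rw [← Fintype.prod_sum (fun (_ : Fin n) a => w a)]; simp [hw1]
  · calc ∑ k, (d (x k) (Classical.arbitrary Y) : ℝ) ≤ ∑ _k : Fin n, L :=
        Finset.sum_le_sum fun k _ => hL _ _
      _ = _ := by simp
  · have h1 : (occurrences x a : ℝ) ≤ n := by exact_mod_cast occurrences_le x a
    have h2 : w a ≤ 1 := by
      rw [← hw1]; exact Finset.single_le_sum (fun b _ => hw0 b) (Finset.mem_univ a)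
    have h3 : (n : ℝ) * w a ≤ n := mul_le_of_le_one_right (by positivity) h2
    have h4 : 0 ≤ (n : ℝ) * w a := mul_nonneg (by positivity) (hw0 a)
    rw [abs_le]
    constructor <;> linarith [(Nat.cast_nonneg (occurrences x a) : (0 : ℝ) ≤ _)]

lemma HasPopularBlock.replicate [Fintype X] [DecidableEq X] {w : X → ℝ} (hw0 : ∀ a, 0 ≤ w a) (hw1 : ∑ a, w a = 1)
    {d : X → Y → ℝ≥0} {L : ℝ} (hL : ∀ a b, (d a b : ℝ) ≤ L) [Nonempty Y] {m : ℕ} {p B c : ℝ}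
    (hp : 0 ≤ p) (h : HasPopularBlock w d m p B c) (q : ℕ) :
    HasPopularBlock w d (q * m) (p ^ q) (q * B) (q * c) := by
  induction q with
  | zero => simpa using hasPopularBlock_univ hw0 hw1 hL 0
  | succ q ih =>
    have := ih.append (pow_nonneg hp q) hp h
    rw [Nat.succ_mul, pow_succ]
    push_cast
    convert this using 1 <;> ring

/-- Permutations of a popular block cover all blocks with the right letter frequencies. -/
lemma HasPopularBlock.exists_cover [Fintype X] [DecidableEq X] {w : X → ℝ} (hw0 : ∀ a, 0 ≤ w a) (hw1 : ∑ a, w a = 1)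
    {d : X → Y → ℝ≥0} {L : ℝ} (hL0 : 0 ≤ L) (hL : ∀ a b, (d a b : ℝ) ≤ L) {n : ℕ} {p B c : ℝ}
    (hp : 0 < p) (hp1 : p ≤ 1) (h : HasPopularBlock w d n p B c) (K : ℕ)
    (hK : (1 - p) ^ K * (Fintype.card X : ℝ) ^ n < 1) :
    ∃ y : Fin K → Fin n → Y, ∀ x : Fin n → X,
      (∀ a, |(occurrences x a : ℝ) - n * w a| ≤ c) →
      ∃ i, ∑ k, (d (x k) (y i k) : ℝ) ≤ B + Fintype.card X * (2 * c) * L := by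
  classical
  obtain ⟨E, y, hE, hx⟩ := h
  obtain ⟨z, hz⟩ := exists_perm_average_le hw0 hw1 E
  have hcard : (0 : ℝ) < Fintype.card (Equiv.Perm (Fin n)) := by exact_mod_cast Fintype.card_pos
  have hz' : p * Fintype.card (Equiv.Perm (Fin n)) ≤ _ :=
    (mul_le_mul_of_nonneg_right hE hcard.le).trans hz
  -- Some rearrangement of `z` lies in `E`, and letter counts do not change under rearrangement.
  have hzc : ∀ a, |(occurrences z a : ℝ) - n * w a| ≤ c := by
    have : 0 < (Finset.univ.filter fun π : Equiv.Perm (Fin n) => z ∘ π ∈ E).card := by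
      have := (mul_pos hp hcard).trans_le hz'
      exact_mod_cast this
    obtain ⟨π, hπ⟩ := Finset.card_pos.1 this
    have := (hx _ (Finset.mem_filter.1 hπ).2).2
    simpa only [occurrences_comp_perm] using this
  let r : (Fin n → X) → Equiv.Perm (Fin n) → Prop := fun x π =>
    ∃ e ∈ E, (mismatch (x ∘ π) e : ℝ) ≤ Fintype.card X * (2 * c)
  let S : Finset (Fin n → X) :=
    Finset.univ.filter fun x => ∀ a, |(occurrences x a : ℝ) - n * w a| ≤ c
  -- The letter counts of `x` and `z` differ by at most `2 * c`, so some `σ` nearly aligns `x` with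
  -- `z`. Then `π ↦ σ * π` injects the permutations which take `z` into `E` into those which take
  -- `x` near `E`; hence the latter also have fraction at least `p`.
  obtain ⟨π, hπ⟩ := exists_small_cover r S hp1 (fun x hxS => by
    have hxc := (Finset.mem_filter.1 hxS).2
    obtain ⟨σ, hσ⟩ := exists_perm_mismatch_le x z
    have hσ' : (mismatch (x ∘ σ) z : ℝ) ≤ Fintype.card X * (2 * c) := by
      calc (mismatch (x ∘ σ) z : ℝ) ≤ ∑ a, ((occurrences z a - occurrences x a : ℕ) : ℝ) := by
            exact_mod_cast hσ
        _ ≤ ∑ _a : X, 2 * c := by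
            refine Finset.sum_le_sum fun a _ => ?_
            have h1 := abs_le.1 (hzc a)
            have h2 := abs_le.1 (hxc a)
            rcases le_total (occurrences z a) (occurrences x a) with h | h
            · rw [Nat.sub_eq_zero_of_le h]; push_cast; linarith
            · rw [Nat.cast_sub h]; linarith
        _ = _ := by simp
    refine hz'.trans ?_
    norm_cast
    refine Finset.card_le_card_of_injOn (fun π => σ * π) (fun π hπ => ?_)
      (fun π _ π' _ h => mul_left_cancel h)
    have hπ' : z ∘ π ∈ E := (Finset.mem_filter.1 hπ).2
    refine Finset.mem_filter.2 ⟨Finset.mem_univ _, z ∘ π, hπ', ?_⟩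
    refine le_trans (le_of_eq ?_) hσ'
    norm_cast
    refine Finset.card_equiv π fun k => ?_
    rw [Finset.mem_filter, Finset.mem_filter]
    simp) K
  refine ⟨fun i => y ∘ (π i).symm, fun x hxc => ?_⟩
  have hcov : ∃ i, r x (π i) := by
    by_contra hcon
    push Not at hcon
    have hmem : x ∈ S.filter fun a => ∀ i, ¬ r a (π i) :=
      Finset.mem_filter.2 ⟨Finset.mem_filter.2 ⟨Finset.mem_univ _, hxc⟩, hcon⟩
    have h1 : (1 : ℝ) ≤ (S.filter fun a => ∀ i, ¬ r a (π i)).card := by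
      exact_mod_cast Finset.card_pos.2 ⟨x, hmem⟩
    have h2 : (S.card : ℝ) ≤ (Fintype.card X : ℝ) ^ n := by
      have : S.card ≤ Fintype.card (Fin n → X) := Finset.card_le_univ S
      rw [Fintype.card_fun, Fintype.card_fin] at this
      exact_mod_cast this
    have h3 := mul_le_mul_of_nonneg_left h2 (pow_nonneg (sub_nonneg.2 hp1) K)
    linarith
  obtain ⟨i, e, heE, he⟩ := hcov
  refine ⟨i, ?_⟩
  calc ∑ k, (d (x k) ((y ∘ (π i).symm) k) : ℝ)
      = ∑ k, (d (x (π i k)) (y k) : ℝ) := by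
        rw [← Equiv.sum_comp (π i)]; simp
    -- Passing from `e ∈ E` to the rearranged `x` costs at most `L` at each mismatch.
    _ ≤ ∑ k, ((d (e k) (y k) : ℝ) + if x (π i k) ≠ e k then L else 0) := by
        refine Finset.sum_le_sum fun k _ => ?_
        split_ifs with hk
        · linarith [hL (x (π i k)) (y k), (d (e k) (y k)).2]
        · rw [not_not.1 hk]; simp
    _ = ∑ k, (d (e k) (y k) : ℝ) + mismatch (x ∘ π i) e * L := by
        rw [Finset.sum_add_distrib, ← Finset.sum_filter, Finset.sum_const, nsmul_eq_mul]; rfl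
    _ ≤ _ := by
        refine add_le_add (hx e heE).1 ?_
        exact mul_le_mul_of_nonneg_right he hL0

/-- Changing a few letters to the best ones decreases the distortion, if the best letters do. -/
lemma exists_mismatch_le_distortion_le [DecidableEq Y] {ι : Type} [Fintype ι] [DecidableEq ι]
    {d : X → Y → ℝ≥0} {best : X → Y} {η : ℝ}
    (hη : ∀ a b, d a b ≠ d a (best a) → (d a (best a) : ℝ) + η ≤ d a b)
    (x : ι → X) (y : ι → Y) {B e : ℝ} {t : ℕ} (ht : e ≤ t * η)
    (hbest : ∑ k, (d (x k) (best (x k)) : ℝ) ≤ B) (hy : ∑ k, (d (x k) (y k) : ℝ) ≤ B + e) :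
    ∃ y' : ι → Y, mismatch y' y ≤ t ∧ ∑ k, (d (x k) (y' k) : ℝ) ≤ B := by
  classical
  set S := Finset.univ.filter fun k => d (x k) (y k) ≠ d (x k) (best (x k)) with hS
  have hmis : ∀ S' : Finset ι, mismatch (fun k => if k ∈ S' then best (x k) else y k) y ≤ S'.card := by
    intro S'
    refine Finset.card_le_card fun k hk => ?_
    by_contra hk'
    exact (Finset.mem_filter.1 hk).2 (if_neg hk')
  -- Either all non-optimal positions can be improved, and the best distortion is reached, or `t` of
  -- them are improved, each saving at least `η`, which pays for the excess `e`.
  rcases le_total S.card t with h | h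
  · refine ⟨fun k => if k ∈ S then best (x k) else y k, (hmis S).trans h, ?_⟩
    refine le_trans (le_of_eq (Finset.sum_congr rfl fun k _ => ?_)) hbest
    dsimp only
    split_ifs with hk
    · rfl
    · simp only [hS, Finset.mem_filter, Finset.mem_univ, true_and, not_not] at hk
      rw [hk]
  · obtain ⟨S', hS', hcard⟩ := Finset.exists_subset_card_eq h
    refine ⟨fun k => if k ∈ S' then best (x k) else y k, (hmis S').trans hcard.le, ?_⟩
    have h1 : ∑ k, ((d (x k) (if k ∈ S' then best (x k) else y k) : ℝ) + if k ∈ S' then η else 0) ≤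
        ∑ k, (d (x k) (y k) : ℝ) := by
      refine Finset.sum_le_sum fun k _ => ?_
      split_ifs with hk
      · exact hη _ _ (Finset.mem_filter.1 (hS' hk)).2
      · simp
    rw [Finset.sum_add_distrib, ← Finset.sum_filter, Finset.sum_const, Finset.filter_mem_eq_inter,
      Finset.univ_inter, hcard, nsmul_eq_mul] at h1
    linarith

end Covering

/-! ### Small codebooks from one popular block -/

section Codebook

variable {X Y : Type} [DecidableEq X]

lemma HasPopularBlock.mono {w : X → ℝ} {d : X → Y → ℝ≥0} {n : ℕ} {p B c p' B' c' : ℝ}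
    (h : HasPopularBlock w d n p B c) (hp : p' ≤ p) (hB : B ≤ B') (hc : c ≤ c') :
    HasPopularBlock w d n p' B' c' := by
  obtain ⟨E, y, hE, hx⟩ := h
  exact ⟨E, y, hp.trans hE, fun x hxE => ⟨(hx x hxE).1.trans hB, fun a => ((hx x hxE).2 a).trans hc⟩⟩

/-- A popular block of some length gives popular blocks of all lengths, by repetition. -/
lemma HasPopularBlock.extend [Fintype X] {w : X → ℝ} (hw0 : ∀ a, 0 ≤ w a) (hw1 : ∑ a, w a = 1)
    {d : X → Y → ℝ≥0} {L : ℝ} (hL0 : 0 ≤ L) (hL : ∀ a b, (d a b : ℝ) ≤ L) [Nonempty Y] {m : ℕ}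
    (hm : 0 < m) {D R δ : ℝ} (hR : 0 ≤ R) (hδ : 0 ≤ δ)
    (h : HasPopularBlock w d m (2 ^ (-(m * R))) (m * D) (δ * m)) (n : ℕ) :
    HasPopularBlock w d n (2 ^ (-(n * R))) (n * D + m * L) (δ * n + m) := by
  -- Needed because the repetitions fill only `n / m * m ≤ n` positions.
  have hD : 0 ≤ D := by
    obtain ⟨E, y, hE, hx⟩ := h
    have hpos : (0 : ℝ) < 2 ^ (-(m * R)) := by positivity
    obtain ⟨x, hxE⟩ : E.Nonempty := by
      by_contra hne
      rw [Finset.not_nonempty_iff_eq_empty.1 hne] at hE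
      simp at hE
      linarith
    have h1 := (hx x hxE).1
    have h2 : 0 ≤ ∑ k, (d (x k) (y k) : ℝ) := Finset.sum_nonneg fun k _ => (d _ _).2
    have h3 : (0 : ℝ) < m := by exact_mod_cast hm
    by_contra hneg
    push Not at hneg
    linarith [mul_neg_of_pos_of_neg h3 hneg]
  have key := (h.replicate hw0 hw1 hL (by positivity) (n / m)).append (by positivity) zero_le_one
    (hasPopularBlock_univ hw0 hw1 hL (n % m))
  have hn : n / m * m + n % m = n := Nat.div_add_mod' n m
  have hnr : ((n / m : ℕ) : ℝ) * m + (n % m : ℕ) = n := by exact_mod_cast hn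
  have hr : ((n % m : ℕ) : ℝ) ≤ m := by exact_mod_cast (Nat.mod_lt n hm).le
  have hr0 : (0 : ℝ) ≤ (n % m : ℕ) := by positivity
  rw [hn] at key
  refine key.mono ?_ ?_ ?_
  · rw [mul_one, ← Real.rpow_natCast, ← Real.rpow_mul (by norm_num)]
    refine Real.rpow_le_rpow_of_exponent_le (by norm_num) ?_
    nlinarith
  · nlinarith
  · nlinarith

/-- About `n * N / p` greedy rounds suffice, since `(1 - p) ^ K ≤ exp (-p * K)` and `N ^ n ≤ exp (n
* N)`. With `p = 2 ^ (-(n * R))` this is rate `R` up to a factor linear in `n`. -/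
lemma exists_cover_count {p N : ℝ} (hp : 0 < p) (hp1 : p ≤ 1) (hN : 1 ≤ N) (n : ℕ) :
    ∃ K : ℕ, (1 - p) ^ K * N ^ n < 1 ∧ (K : ℝ) ≤ (n * N + 1) * p⁻¹ := by
  refine ⟨⌊n * N * p⁻¹⌋₊ + 1, ?_, ?_⟩
  · set K := ⌊n * N * p⁻¹⌋₊ + 1 with hK
    have hKlt : n * N * p⁻¹ < K := by
      rw [hK]; push_cast; exact Nat.lt_floor_add_one _
    have h1 : (1 - p) ^ K ≤ Real.exp (-(p * K)) := by
      calc (1 - p) ^ K ≤ (Real.exp (-p)) ^ K := by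
            refine pow_le_pow_left₀ (by linarith) ?_ K
            linarith [Real.add_one_le_exp (-p)]
        _ = _ := by rw [← Real.exp_nat_mul]; ring_nf
    have h2 : N ^ n ≤ Real.exp (n * N) := by
      rw [Real.exp_nat_mul]
      refine pow_le_pow_left₀ (by linarith) ?_ n
      linarith [Real.add_one_le_exp N]
    calc (1 - p) ^ K * N ^ n ≤ Real.exp (-(p * K)) * Real.exp (n * N) :=
          mul_le_mul h1 h2 (by positivity) (by positivity)
      _ = Real.exp (n * N - p * K) := by rw [← Real.exp_add]; ring_nf
      _ < 1 := by
          rw [Real.exp_lt_one_iff]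
          have := mul_lt_mul_of_pos_left hKlt hp
          have h3 : p * (n * N * p⁻¹) = n * N := by field_simp
          linarith
  · push_cast
    have h1 : (⌊n * N * p⁻¹⌋₊ : ℝ) ≤ n * N * p⁻¹ := Nat.floor_le (by positivity)
    have h2 : 1 ≤ p⁻¹ := (one_le_inv₀ hp).2 hp1
    linarith

/-- If some block is popular, then there are small codebooks for all large block lengths. -/
lemma exists_codebook [Fintype X] [Nonempty Y] [Fintype Y] [DecidableEq Y]
    {w : X → ℝ} (hw0 : ∀ a, 0 ≤ w a) (hw1 : ∑ a, w a = 1)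
    (d : X → Y → ℝ≥0) {best : X → Y} {η : ℝ} (hη0 : 0 < η)
    (hη : ∀ a b, d a b ≠ d a (best a) → (d a (best a) : ℝ) + η ≤ d a b) {R R₁ : ℝ} (hR : 0 ≤ R)
    (hRR : R < R₁) :
    ∃ δ > 0, ∀ (D : ℝ) (m : ℕ), 0 < m →
      HasPopularBlock w d m (2 ^ (-(m * R))) (m * D) (δ * m) →
      ∀ᶠ n : ℕ in atTop, ∃ 𝒞 : Finset (Fin n → Y), (𝒞.card : ℝ) ≤ 2 ^ ((n : ℝ) * R₁) ∧
        ∀ x : Fin n → X, (∀ a, |(occurrences x a : ℝ) - n * w a| ≤ δ * n) →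
          ∑ k, (d (x k) (best (x k)) : ℝ) ≤ n * D → ∃ y ∈ 𝒞, ∑ k, (d (x k) (y k) : ℝ) ≤ n * D := by
  classical
  obtain ⟨L, hL0, hL⟩ : ∃ L : ℝ, 0 ≤ L ∧ ∀ a b, (d a b : ℝ) ≤ L :=
    ⟨∑ a, ∑ b, (d a b : ℝ), by positivity, fun a b =>
      (Finset.single_le_sum (f := fun b => (d a b : ℝ)) (fun b _ => (d a b).2)
        (Finset.mem_univ b)).trans
      (Finset.single_le_sum (f := fun a => ∑ b, (d a b : ℝ))
        (fun a _ => Finset.sum_nonneg fun b _ => (d a b).2) (Finset.mem_univ a))⟩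
  have hX : (1 : ℝ) ≤ Fintype.card X := by
    have : Nonempty X := by
      by_contra hne
      rw [not_nonempty_iff] at hne
      simp at hw1
    exact_mod_cast Fintype.card_pos
  set N : ℝ := (Fintype.card X : ℝ) with hN
  set ε := R₁ - R with hε
  have hε0 : 0 < ε := sub_pos.2 hRR
  have h2ε : (1 : ℝ) < 2 ^ (ε / 4) := Real.one_lt_rpow (by norm_num) (by positivity)
  -- parameter of the bound on the volume of a Hamming ball
  obtain ⟨l, hl0, hl1, hl⟩ : ∃ l : ℝ, 0 < l ∧ l ≤ 1 ∧ 1 + Fintype.card Y * l ≤ 2 ^ (ε / 4) := by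
    have hY : (0 : ℝ) < Fintype.card Y := by exact_mod_cast Fintype.card_pos
    refine ⟨min 1 ((2 ^ (ε / 4) - 1) / Fintype.card Y), lt_min one_pos
      (div_pos (by linarith) hY), min_le_left _ _, ?_⟩
    have := (le_div_iff₀' hY).1 (min_le_right 1 ((2 ^ (ε / 4) - 1) / (Fintype.card Y : ℝ)))
    linarith
  -- fraction of the letters which may be changed
  obtain ⟨τ, hτ0, hτ⟩ : ∃ τ : ℝ, 0 < τ ∧ l⁻¹ ^ τ ≤ 2 ^ (ε / 4) := by
    have hc : ContinuousAt (fun τ : ℝ => l⁻¹ ^ τ) 0 :=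
      Real.continuousAt_const_rpow (inv_pos.2 hl0).ne'
    have he : ∀ᶠ τ in 𝓝 (0 : ℝ), l⁻¹ ^ τ < 2 ^ (ε / 4) :=
      hc.eventually_lt_const (by simpa using h2ε)
    obtain ⟨τ, h1, h2⟩ := ((he.filter_mono nhdsWithin_le_nhds).and
      (self_mem_nhdsWithin (s := Set.Ioi (0 : ℝ)))).exists
    exact ⟨τ, h2, h1.le⟩
  -- The tolerance makes the cost `N * (2 * (2 * δ * n)) * L` of unequal letter counts at most `τ *
  -- η * n / 2`; `L + 1` avoids division by zero. It is fixed before `D` and `m`, so that the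
  -- typical set does not depend on the popular block.
  refine ⟨τ * η / (8 * N * (L + 1)), by positivity, ?_⟩
  set δ := τ * η / (8 * N * (L + 1)) with hδ
  have hδ0 : 0 < δ := by positivity
  intro D m hm hpop
  -- The first bound absorbs the filler of length at most `m` into the frequency tolerance `2 * δ *
  -- n`; the second lets the filler's distortion and the rounding of `t` use at most the other half
  -- of `τ * n`.
  have hlin : ∀ᶠ n : ℕ in atTop, (m / δ : ℝ) ≤ n ∧ ((m * L / η + 1) * 2 / τ : ℝ) ≤ n :=
    (tendsto_natCast_atTop_atTop.eventually_ge_atTop _).and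
      (tendsto_natCast_atTop_atTop.eventually_ge_atTop _)
  have hexp : ∀ᶠ n : ℕ in atTop, (n : ℝ) * N + 1 ≤ 2 ^ ((n : ℝ) * (ε / 2)) := by
    have hr : (1 : ℝ) < 2 ^ (ε / 2) := Real.one_lt_rpow (by norm_num) (by positivity)
    have h1 := ((tendsto_pow_const_div_const_pow_of_one_lt 1 hr).const_mul N).add
      (tendsto_pow_const_div_const_pow_of_one_lt 0 hr)
    rw [mul_zero, add_zero] at h1
    filter_upwards [h1.eventually_le_const one_pos] with n hn
    have hpow : (2 : ℝ) ^ ((n : ℝ) * (ε / 2)) = (2 ^ (ε / 2)) ^ n := by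
      rw [← Real.rpow_mul_natCast (by norm_num)]; ring_nf
    have hpos : (0 : ℝ) < (2 ^ (ε / 2)) ^ n := by positivity
    rw [hpow]
    rw [pow_one, pow_zero, ← mul_div_assoc, ← add_div, div_le_one hpos] at hn
    linarith
  filter_upwards [hlin, hexp] with n hn1 hn2
  obtain ⟨hnδ, hnτ⟩ := hn1
  have hp0 : (0 : ℝ) < 2 ^ (-((n : ℝ) * R)) := by positivity
  have hp1 : (2 : ℝ) ^ (-((n : ℝ) * R)) ≤ 1 :=
    Real.rpow_le_one_of_one_le_of_nonpos (by norm_num) (neg_nonpos.2 (by positivity))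
  obtain ⟨K, hK1, hK2⟩ := exists_cover_count hp0 hp1 hX n
  have hmδ : (m : ℝ) ≤ δ * n := by rwa [div_le_iff₀' hδ0] at hnδ
  have hpop' : HasPopularBlock w d n (2 ^ (-(n * R))) (n * D + m * L) (2 * (δ * n)) :=
    (hpop.extend hw0 hw1 hL0 hL hm hR hδ0.le n).mono le_rfl le_rfl (by linarith)
  obtain ⟨y, hy⟩ := hpop'.exists_cover hw0 hw1 hL0 hL hp0 hp1 K hK1
  set e : ℝ := m * L + N * (2 * (2 * (δ * n))) * L with he
  have he0 : 0 ≤ e := by positivity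
  set t := ⌈e / η⌉₊ with ht
  have hte : e ≤ t * η := by
    rw [← div_le_iff₀ hη0]; exact Nat.le_ceil _
  have htn : (t : ℝ) ≤ τ * n := by
    have h1 : (t : ℝ) < e / η + 1 := Nat.ceil_lt_add_one (by positivity)
    have h2 : N * (2 * (2 * (δ * n))) * L ≤ τ * η * n / 2 := by
      have : N * (2 * (2 * (δ * n))) * (L + 1) = τ * η * n / 2 := by
        rw [hδ]; field_simp; ring
      rw [← this]
      gcongr
      linarith
    have h3 : e / η ≤ m * L / η + τ * n / 2 := by
      rw [div_le_iff₀ hη0, he]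
      have : (m * L / η + τ * n / 2) * η = m * L + τ * η * n / 2 := by field_simp
      rw [this]; linarith
    have h4 : (m * L / η + 1) * 2 ≤ τ * n := by rwa [div_le_iff₀' hτ0] at hnτ
    linarith
  -- Rate budget: `R + ε / 2` for the number of centres and `ε / 2` for the balls, in total `R₁`.
  refine ⟨Finset.univ.biUnion fun i => Finset.univ.filter fun y' => mismatch y' (y i) ≤ t, ?_, ?_⟩
  · have hball : ∀ i, ((Finset.univ.filter fun y' => mismatch y' (y i) ≤ t).card : ℝ) ≤
        2 ^ ((n : ℝ) * (ε / 2)) := by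
      intro i
      refine (card_mismatch_le (y i) t hl0 hl1).trans ?_
      have h1 : l⁻¹ ^ t ≤ 2 ^ ((n : ℝ) * (ε / 4)) := by
        calc l⁻¹ ^ t = l⁻¹ ^ (t : ℝ) := (Real.rpow_natCast _ _).symm
          _ ≤ l⁻¹ ^ (τ * n) := Real.rpow_le_rpow_of_exponent_le ((one_le_inv₀ hl0).2 hl1) htn
          _ = (l⁻¹ ^ τ) ^ (n : ℝ) := Real.rpow_mul (by positivity) _ _
          _ ≤ (2 ^ (ε / 4)) ^ (n : ℝ) := Real.rpow_le_rpow (by positivity) hτ (by positivity)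
          _ = _ := by rw [← Real.rpow_mul (by norm_num)]; ring_nf
      have h2 : (1 + Fintype.card Y * l) ^ Fintype.card (Fin n) ≤ 2 ^ ((n : ℝ) * (ε / 4)) := by
        rw [Fintype.card_fin]
        calc (1 + Fintype.card Y * l) ^ n ≤ (2 ^ (ε / 4)) ^ n :=
              pow_le_pow_left₀ (by positivity) hl n
          _ = _ := by rw [← Real.rpow_mul_natCast (by norm_num)]; ring_nf
      calc _ ≤ (2 : ℝ) ^ ((n : ℝ) * (ε / 4)) * 2 ^ ((n : ℝ) * (ε / 4)) :=
            mul_le_mul h1 h2 (by positivity) (by positivity)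
        _ = _ := by rw [← Real.rpow_add (by norm_num)]; ring_nf
    calc _ ≤ ((∑ i : Fin K, (Finset.univ.filter fun y' => mismatch y' (y i) ≤ t).card : ℕ) : ℝ) := by
          exact_mod_cast Finset.card_biUnion_le
      _ ≤ ∑ _i : Fin K, (2 : ℝ) ^ ((n : ℝ) * (ε / 2)) := by
          push_cast; exact Finset.sum_le_sum fun i _ => hball i
      _ = K * 2 ^ ((n : ℝ) * (ε / 2)) := by simp
      _ ≤ (2 ^ ((n : ℝ) * (ε / 2)) * 2 ^ ((n : ℝ) * R)) * 2 ^ ((n : ℝ) * (ε / 2)) := by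
          gcongr
          refine hK2.trans ?_
          rw [Real.rpow_neg (by norm_num), inv_inv]
          gcongr
      _ = _ := by
          rw [← Real.rpow_add (by norm_num), ← Real.rpow_add (by norm_num), hε]; ring_nf
  · intro x hx hbest
    obtain ⟨i, hi⟩ := hy x fun a => (hx a).trans 
      (by linarith [mul_nonneg hδ0.le (Nat.cast_nonneg (α := ℝ) n)])
    obtain ⟨y', hy'1, hy'2⟩ := exists_mismatch_le_distortion_le hη x (y i) hte hbest
      (hi.trans (by rw [he]; linarith))
    exact ⟨y', Finset.mem_biUnion.2 ⟨i, Finset.mem_univ _, Finset.mem_filter.2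
      ⟨Finset.mem_univ _, hy'1⟩⟩, hy'2⟩

end Codebook

/-! ### Packing below the rate-distortion function -/

section Packing

variable {X Y : Type}

lemma msgCount_pos (R : ℝ≥0) (n : ℕ) : 0 < msgCount R n :=
  Nat.floor_pos.2 (Real.one_le_rpow (by norm_num) (by positivity))

lemma msgCount_mono {R R' : ℝ≥0} (h : R ≤ R') (n : ℕ) : msgCount R n ≤ msgCount R' n :=
  Nat.floor_mono (Real.rpow_le_rpow_of_exponent_le (by norm_num) (by gcongr))

lemma avgDistortion_le_iff (d : X → Y → ℝ≥0) {n : ℕ} (hn : 0 < n) (x : Fin n → X) (y : Fin n → Y)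
    (D : ℝ) : avgDistortion d x y ≤ D ↔ ∑ k, (d (x k) (y k) : ℝ) ≤ n * D := by
  rw [avgDistortion, div_le_iff₀' (by exact_mod_cast hn)]

/-- A rate above an achievable one is achievable. -/
lemma IsAchievableRate.mono [MeasurableSpace X] {μ : Measure X} {d : X → Y → ℝ≥0} {D : ℝ}
    {R R' : ℝ≥0} (h : IsAchievableRate μ d D R) (hR : R ≤ R') : IsAchievableRate μ d D R' := by
  obtain ⟨enc, dec, h⟩ := h
  have hpos := fun n => msgCount_pos R n
  refine ⟨fun n x => Fin.castLE (msgCount_mono hR n) (enc n x),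
    fun n m => if hm : m.1 < msgCount R n then dec n ⟨m.1, hm⟩ else dec n ⟨0, hpos n⟩, ?_⟩
  simpa [CompressesWithin] using h

lemma isAchievableRate_of_rateDistortion_lt [MeasurableSpace X] {μ : Measure X}
    {d : X → Y → ℝ≥0} {D : ℝ} {R : ℝ≥0} (h : rateDistortion μ d D < R) :
    IsAchievableRate μ d D R := by
  unfold rateDistortion at h
  simp only [iInf_lt_iff] at h
  obtain ⟨R', hR', hlt⟩ := h
  exact hR'.mono (by exact_mod_cast hlt.le)

variable [MeasurableSpace X]

/-- The blocks in which each letter has about its expected frequency. -/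
def typicalSet [DecidableEq X] (μ : Measure X) (δ : ℝ) (n : ℕ) : Set (Fin n → X) :=
  {x | ∀ a, |(occurrences x a : ℝ) - n * μ.real {a}| ≤ δ * n}

/-- Chebyshev's inequality for each letter count, whose variance is at most `n`, and a union bound
over the finite alphabet. -/
lemma tendsto_measure_compl_typicalSet [Fintype X] [DecidableEq X] [DiscreteMeasurableSpace X]
    (μ : Measure X) [IsProbabilityMeasure μ] {δ : ℝ} (hδ : 0 < δ) :
    Tendsto (fun n => (Measure.pi fun _ : Fin n => μ) (typicalSet μ δ n)ᶜ) atTop (𝓝 0) := by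
  have hletter : ∀ (a : X) (n : ℕ), 0 < n → (Measure.pi fun _ : Fin n => μ)
      {x | δ * n ≤ |(occurrences x a : ℝ) - n * μ.real {a}|} ≤ ENNReal.ofReal (1 / δ ^ 2 / n) := by
    intro a n hn
    have hn' : (0 : ℝ) < n := by exact_mod_cast hn
    set f : X → ℝ := Set.indicator {a} 1 with hf
    have hfb : ∀ x, f x ∈ Set.Icc (0 : ℝ) 1 := by
      intro x
      simp only [hf, Set.indicator]
      split_ifs <;> simp
    have hfL : MemLp f 2 μ := MemLp.of_discrete
    set F : (Fin n → X) → ℝ := ∑ k, fun x => f (x k) with hF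
    have hFocc : ∀ x, F x = occurrences x a := by
      intro x
      simp only [hF, Finset.sum_apply, hf, Set.indicator, Set.mem_singleton_iff, Pi.one_apply,
        occurrences, Finset.card_filter]
      push_cast
      rfl
    have hmean : ∫ x, F x ∂(Measure.pi fun _ : Fin n => μ) = n * μ.real {a} := by
      simp only [hF, Finset.sum_apply]
      rw [integral_finsetSum _ fun k _ => Integrable.of_finite]
      have : ∀ k : Fin n, ∫ x, f (x k) ∂(Measure.pi fun _ : Fin n => μ) = μ.real {a} := by
        intro k
        have hmap := integral_map (μ := Measure.pi fun _ : Fin n => μ) (f := f)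
          (measurable_pi_apply k).aemeasurable (by fun_prop)
        rw [← hmap, (measurePreserving_eval (fun _ : Fin n => μ) k).map_eq, hf,
          integral_indicator_one (measurableSet_singleton a)]
      simp [this]
    have hvar : Var[F; Measure.pi fun _ : Fin n => μ] ≤ n := by
      rw [hF, variance_sum_pi fun _ => hfL]
      calc ∑ _k : Fin n, Var[f; μ] ≤ ∑ _k : Fin n, (1 : ℝ) := by
            refine Finset.sum_le_sum fun k _ => ?_
            have := variance_le_sq_of_bounded (μ := μ) (X := f) (a := 0) (b := 1)
              (Eventually.of_forall hfb) (by fun_prop)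
            linarith
        _ = n := by simp
    have hFL : MemLp F 2 (Measure.pi fun _ : Fin n => μ) := MemLp.of_discrete
    have hch := meas_ge_le_variance_div_sq hFL (c := δ * n) (by positivity)
    rw [hmean] at hch
    simp only [hFocc] at hch
    refine hch.trans (ENNReal.ofReal_le_ofReal ?_)
    calc _ ≤ (n : ℝ) / (δ * n) ^ 2 := by gcongr
      _ = _ := by field_simp
  have hlim : Tendsto (fun n : ℕ => ∑ _a : X, ENNReal.ofReal (1 / δ ^ 2 / n)) atTop (𝓝 0) := by
    have h1 : Tendsto (fun n : ℕ => ENNReal.ofReal (1 / δ ^ 2 / n)) atTop (𝓝 0) := by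
      have := ENNReal.tendsto_ofReal (tendsto_const_div_atTop_nhds_zero_nat (1 / δ ^ 2))
      rwa [ENNReal.ofReal_zero] at this
    simpa using tendsto_finsetSum (Finset.univ : Finset X) fun _ _ => h1
  refine tendsto_of_tendsto_of_tendsto_of_le_of_le' tendsto_const_nhds hlim
    (Eventually.of_forall fun _ => zero_le) ?_
  filter_upwards [eventually_gt_atTop 0] with n hn
  have hsub : (typicalSet μ δ n)ᶜ ⊆
      ⋃ a, {x | δ * n ≤ |(occurrences x a : ℝ) - n * μ.real {a}|} := by
    intro x hx
    simp only [typicalSet, Set.mem_compl_iff, Set.mem_ofPred_eq, not_forall, not_le] at hx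
    obtain ⟨a, ha⟩ := hx
    exact Set.mem_iUnion.2 ⟨a, ha.le⟩
  refine (measure_mono hsub).trans ((measure_iUnion_fintype_le _ _).trans ?_)
  exact Finset.sum_le_sum fun a _ => hletter a n hn

lemma measure_pi_eq_sum [Fintype X] [DiscreteMeasurableSpace X] (μ : Measure X)
    [IsProbabilityMeasure μ] {n : ℕ} (E : Finset (Fin n → X)) :
    (Measure.pi fun _ : Fin n => μ) E = ENNReal.ofReal (∑ x ∈ E, ∏ k, μ.real {x k}) := by
  rw [← sum_measure_singleton, ENNReal.ofReal_sum_of_nonneg fun x _ =>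
    Finset.prod_nonneg fun k _ => measureReal_nonneg]
  refine Finset.sum_congr rfl fun x _ => ?_
  rw [Measure.pi_singleton, ENNReal.ofReal_prod_of_nonneg fun k _ => measureReal_nonneg]
  simp

/-- Codebooks of the right size give an achievable rate. -/
lemma isAchievableRate_of_codebooks [Nonempty Y] {μ : Measure X} {d : X → Y → ℝ≥0} {D : ℝ}
    {R : ℝ≥0} {G : ∀ n, Set (Fin n → X)}
    (hG : Tendsto (fun n => (Measure.pi fun _ : Fin n => μ) (G n)ᶜ) atTop (𝓝 0))
    (h : ∀ᶠ n : ℕ in atTop, ∃ 𝒞 : Finset (Fin n → Y), (𝒞.card : ℝ) ≤ 2 ^ ((n : ℝ) * R) ∧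
      ∀ x ∈ G n, ∃ y ∈ 𝒞, avgDistortion d x y ≤ D) : IsAchievableRate μ d D R := by
  classical
  have hcode : ∀ n, ∃ (enc : (Fin n → X) → Fin (msgCount R n))
      (dec : Fin (msgCount R n) → Fin n → Y),
      (∃ 𝒞 : Finset (Fin n → Y), (𝒞.card : ℝ) ≤ 2 ^ ((n : ℝ) * R) ∧
        ∀ x ∈ G n, ∃ y ∈ 𝒞, avgDistortion d x y ≤ D) →
      ∀ x ∈ G n, avgDistortion d x (dec (enc x)) ≤ D := by
    intro n
    by_cases hex : ∃ 𝒞 : Finset (Fin n → Y), (𝒞.card : ℝ) ≤ 2 ^ ((n : ℝ) * R) ∧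
        ∀ x ∈ G n, ∃ y ∈ 𝒞, avgDistortion d x y ≤ D
    · obtain ⟨𝒞, hcard, hcov⟩ := hex
      have hcard' : 𝒞.card ≤ msgCount R n := Nat.le_floor hcard
      obtain ⟨f⟩ : Nonempty (𝒞 ↪ Fin (msgCount R n)) :=
        Function.Embedding.nonempty_of_card_le (by simpa using hcard')
      choose! c hc hcD using hcov
      refine ⟨fun x => if hx : x ∈ G n then f ⟨c x, hc x hx⟩ else ⟨0, msgCount_pos R n⟩,
        Function.extend f Subtype.val fun _ _ => Classical.arbitrary Y, fun _ x hx => ?_⟩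
      dsimp only
      rw [dif_pos hx, f.injective.extend_apply]
      exact hcD x hx
    · exact ⟨fun _ => ⟨0, msgCount_pos R n⟩, fun _ _ => Classical.arbitrary Y,
        fun hex' => absurd hex' hex⟩
  choose enc dec hcode using hcode
  refine ⟨enc, dec, ?_⟩
  refine tendsto_of_tendsto_of_tendsto_of_le_of_le' tendsto_const_nhds hG
    (Eventually.of_forall fun _ => zero_le) ?_
  filter_upwards [h] with n hn
  refine measure_mono fun x hx hxG => ?_
  exact absurd (hcode n hn x hxG) (not_le.2 hx)

/-- Below the rate-distortion function, random codewords are unlikely to be close to any given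
block. -/
lemma exists_packing [Finite X] [DiscreteMeasurableSpace X] [Finite Y] [Nonempty Y]
    (μ : Measure X) [IsProbabilityMeasure μ] (d : X → Y → ℝ≥0) (D : ℝ) {R : ℝ≥0}
    (hR : R < rateDistortion μ d D) :
    ∃ T : ∀ n, Set (Fin n → X),
      Tendsto (fun n => (Measure.pi fun _ : Fin n => μ) (T n)ᶜ) atTop (𝓝 0) ∧
      ∀ f : ∀ n, (Fin n → X) → Fin n → Y,
        Tendsto (fun n => (Measure.pi fun _ : Fin n => μ) {x | D < avgDistortion d x (f n x)})
          atTop (𝓝 0) →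
        Tendsto (fun n => (msgCount R n : ℝ≥0∞) *
          ⨆ y, (Measure.pi fun _ : Fin n => μ) (T n ∩ {x | avgDistortion d x y ≤ D}))
          atTop (𝓝 0) := by
  classical
  have := Fintype.ofFinite X
  have := Fintype.ofFinite Y
  obtain ⟨R₁, hRR₁, hR₁⟩ := ENNReal.lt_iff_exists_nnreal_btwn.1 hR
  have hlt : (R : ℝ) < R₁ := by exact_mod_cast hRR₁
  have hnot : ¬ IsAchievableRate μ d D R₁ := fun hach =>
    absurd (iInf₂_le (f := fun (R : ℝ≥0) (_ : IsAchievableRate μ d D R) => (R : ℝ≥0∞)) R₁ hach)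
      (not_le.2 hR₁)
  have hbest : ∀ a, ∃ b, ∀ b', d a b ≤ d a b' := fun a => Finite.exists_min (d a)
  choose best hbest using hbest
  -- By finiteness there is a uniform gap between the smallest distortion of a letter and any larger
  -- one.
  obtain ⟨η, hη0, hη⟩ : ∃ η : ℝ, 0 < η ∧
      ∀ a b, d a b ≠ d a (best a) → (d a (best a) : ℝ) + η ≤ d a b := by
    have hev : ∀ᶠ η in 𝓝[>] (0 : ℝ),
        ∀ a b, d a b ≠ d a (best a) → (d a (best a) : ℝ) + η ≤ d a b := by
      rw [eventually_all]; intro a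
      rw [eventually_all]; intro b
      by_cases hab : d a b = d a (best a)
      · exact Eventually.of_forall fun _ h => absurd hab h
      · have hpos : (0 : ℝ) < d a b - d a (best a) := by
          have : d a (best a) < d a b := lt_of_le_of_ne (hbest a b) (Ne.symm hab)
          exact sub_pos.2 (by exact_mod_cast this)
        filter_upwards [Ioo_mem_nhdsGT hpos] with η hη _
        linarith [hη.2]
    obtain ⟨η, h1, h2⟩ := (hev.and (self_mem_nhdsWithin (s := Set.Ioi (0 : ℝ)))).exists
    exact ⟨η, h2, h1⟩
  have hw0 : ∀ a, 0 ≤ μ.real {a} := fun a => measureReal_nonneg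
  have hw1 : ∑ a, μ.real {a} = 1 := by
    rw [sum_measureReal_singleton]; simp
  obtain ⟨R', hR'1, hR'2⟩ := exists_between hlt
  have hR'0 : 0 ≤ R' := R.2.trans hR'1.le
  obtain ⟨δ, hδ, hcode⟩ := exists_codebook hw0 hw1 d hη0 hη hR'0 hR'2
  have htyp := tendsto_measure_compl_typicalSet μ hδ
  refine ⟨typicalSet μ δ, htyp, fun f hf => ?_⟩
  -- A violation at a single length `m` would give codebooks of rate `R₁` at all large lengths. The
  -- map `f` ensures that most blocks can be reproduced within `D` at all, which the best-letter
  -- condition of `exists_codebook` requires.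
  have hsmall : ∀ n, 0 < n → ∀ y, (Measure.pi fun _ : Fin n => μ)
      (typicalSet μ δ n ∩ {x | avgDistortion d x y ≤ D}) ≤ ENNReal.ofReal (2 ^ (-(n * R'))) := by
    intro m hm y
    by_contra hcon
    push Not at hcon
    refine hnot (isAchievableRate_of_codebooks
      (G := fun n => typicalSet μ δ n ∩ {x | avgDistortion d x (f n x) ≤ D}) ?_ ?_)
    · have hsum := htyp.add hf
      rw [add_zero] at hsum
      refine tendsto_of_tendsto_of_tendsto_of_le_of_le tendsto_const_nhds hsum
        (fun _ => zero_le) fun n => ?_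
      refine (measure_mono ?_).trans (measure_union_le _ _)
      rw [Set.compl_inter]
      exact Set.union_subset_union_right _ fun x hx => by simpa using hx
    · have hpop : HasPopularBlock (fun a => μ.real {a}) d m (2 ^ (-(m * R'))) (m * D) (δ * m) := by
        refine ⟨(typicalSet μ δ m ∩ {x | avgDistortion d x y ≤ D}).toFinset, y, ?_, ?_⟩
        · rw [← Set.coe_toFinset (typicalSet μ δ m ∩ _), measure_pi_eq_sum] at hcon
          exact (ENNReal.ofReal_lt_ofReal_iff_of_nonneg (by positivity)).1 hcon |>.le
        · intro x hx
          rw [Set.mem_toFinset] at hx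
          exact ⟨(avgDistortion_le_iff d hm x y D).1 hx.2, hx.1⟩
      filter_upwards [hcode D m hm hpop, eventually_gt_atTop 0] with n hn hn0
      obtain ⟨𝒞, hcard, hcov⟩ := hn
      refine ⟨𝒞, hcard, fun x hx => ?_⟩
      obtain ⟨y, hy, hyD⟩ := hcov x hx.1 (le_trans
        (Finset.sum_le_sum fun k _ => by exact_mod_cast hbest _ _)
        ((avgDistortion_le_iff d hn0 x _ D).1 hx.2))
      exact ⟨y, hy, (avgDistortion_le_iff d hn0 x y D).2 hyD⟩
  have hlim : Tendsto (fun n : ℕ => ENNReal.ofReal ((2 ^ (-(R' - R))) ^ n)) atTop (𝓝 0) := by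
    have := ENNReal.tendsto_ofReal (tendsto_pow_atTop_nhds_zero_of_lt_one
      (r := (2 : ℝ) ^ (-(R' - R))) (by positivity)
      (Real.rpow_lt_one_of_one_lt_of_neg (by norm_num) (by linarith)))
    rwa [ENNReal.ofReal_zero] at this
  refine tendsto_of_tendsto_of_tendsto_of_le_of_le' tendsto_const_nhds hlim
    (Eventually.of_forall fun _ => zero_le) ?_
  filter_upwards [eventually_gt_atTop 0] with n hn
  have h1 : (msgCount R n : ℝ≥0∞) ≤ ENNReal.ofReal (2 ^ ((n : ℝ) * R)) := by
    rw [← ENNReal.ofReal_natCast]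
    exact ENNReal.ofReal_le_ofReal (Nat.floor_le (by positivity))
  calc _ ≤ ENNReal.ofReal (2 ^ ((n : ℝ) * R)) * ENNReal.ofReal (2 ^ (-(n * R'))) :=
        mul_le_mul' h1 (iSup_le fun y => hsmall n hn y)
    _ = _ := by
        rw [← ENNReal.ofReal_mul (by positivity), ← Real.rpow_add (by norm_num),
          ← Real.rpow_mul_natCast (by norm_num)]
        ring_nf

end Packing

/-! ### Transport of composed laws and substitution of independent variables -/

section MeasureTools

variable {P P' Sg V : Type} [MeasurableSpace P] [MeasurableSpace P'] [MeasurableSpace Sg]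
  [MeasurableSpace V]

lemma map_compProd_of_comap (π : Measure P) [SFinite π] (K : Kernel P Sg) [IsSFiniteKernel K]
    (K' : Kernel P' Sg) [IsSFiniteKernel K'] {φ : P → P'} (hφ : Measurable φ)
    (hK : ∀ x, K x = K' (φ x)) :
    (π ⊗ₘ K).map (Prod.map φ id) = (π.map φ) ⊗ₘ K' := by
  ext s hs
  rw [Measure.map_apply (by fun_prop) hs, Measure.compProd_apply (by measurability),
    Measure.compProd_apply hs, lintegral_map (Kernel.measurable_kernel_prodMk_left hs) hφ]
  refine lintegral_congr fun x => ?_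
  rw [hK]
  rfl

/-- The signals depend on `x` only through `φ x`, so a variable `u x` independent of `φ x` is also
independent of the signals. -/
lemma map_compProd_eq_prod (π : Measure P) [SFinite π] (K : Kernel P Sg) [IsSFiniteKernel K]
    (π' : Measure P') [SFinite π'] (K' : Kernel P' Sg) [IsSFiniteKernel K']
    (ζ : Measure V) [SFinite ζ] {φ : P → P'} (hφ : Measurable φ) {u : P → V} (hu : Measurable u)
    (hK : ∀ x, K x = K' (φ x)) (hπ : π.map (fun x => (u x, φ x)) = ζ.prod π') :
    (π ⊗ₘ K).map (fun w => (u w.1, φ w.1, w.2)) = ζ.prod (π' ⊗ₘ K') := by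
  refine Measure.ext_of_lintegral _ fun f hf => ?_
  have hH : Measurable fun z : V × P' => ∫⁻ s, f (z.1, z.2, s) ∂(K' z.2) := by
    have := Measurable.lintegral_kernel_prod_right' (κ := K'.comap Prod.snd measurable_snd)
      (f := fun z : (V × P') × Sg => f (z.1.1, z.1.2, z.2)) (by fun_prop)
    exact this
  rw [lintegral_map hf (by fun_prop), Measure.lintegral_compProd (by fun_prop)]
  simp_rw [hK]
  have h1 := lintegral_map (μ := π) hH (hu.prodMk hφ)
  rw [hπ, lintegral_prod _ hH.aemeasurable] at h1
  rw [lintegral_prod _ hf.aemeasurable]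
  refine h1.symm.trans (lintegral_congr fun v => ?_)
  rw [Measure.lintegral_compProd (by fun_prop)]

/-- Given the data `b`, the substitute `G (b, c')` has law `ζ` for almost every `b` and involves
none of the other variables. This is what replaces messages and codebooks by codewords. -/
lemma map_prod_substitute {B N C C' S Z : Type} [MeasurableSpace B] [MeasurableSpace N]
    [MeasurableSpace C] [MeasurableSpace C'] [MeasurableSpace S] [MeasurableSpace Z]
    (β : Measure B) [IsProbabilityMeasure β] (ν : Measure N) [IsProbabilityMeasure ν]
    (κ : Measure C) [IsProbabilityMeasure κ] (κ' : Measure C') [IsProbabilityMeasure κ']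
    (σ : Measure S) [IsProbabilityMeasure σ] (ζ : Measure Z) [IsProbabilityMeasure ζ]
    {G : B × C' → Z} (hG : Measurable G) (h : ∀ᵐ b ∂β, κ'.map (fun c' => G (b, c')) = ζ) :
    (β.prod (ν.prod ((κ.prod κ').prod σ))).map
      (fun w => (G (w.1, w.2.2.1.2), w.2.1, w.2.2.1.1, w.2.2.2)) =
      ζ.prod (ν.prod (κ.prod σ)) := by
  refine Measure.ext_of_lintegral _ fun f hf => ?_
  rw [lintegral_map hf (by fun_prop), lintegral_prod _ (by fun_prop)]
  have hb : ∀ᵐ b ∂β, ∫⁻ y, f (G (b, y.2.1.2), y.1, y.2.1.1, y.2.2) ∂(ν.prod ((κ.prod κ').prod σ)) =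
      ∫⁻ z, f z ∂(ζ.prod (ν.prod (κ.prod σ))) := by
    filter_upwards [h] with b hb
    have hz : ∀ n c, ∫⁻ c', ∫⁻ s, f (G (b, c'), n, c, s) ∂σ ∂κ' = ∫⁻ z, ∫⁻ s, f (z, n, c, s) ∂σ ∂ζ := by
      intro n c
      rw [← hb, lintegral_map (Measurable.lintegral_prod_right' (f := fun w : Z × S =>
        f (w.1, n, c, w.2)) (by fun_prop)) (by fun_prop)]
    have hm1 : Measurable fun w : N × C × Z => ∫⁻ s, f (w.2.2, w.1, w.2.1, s) ∂σ :=
      Measurable.lintegral_prod_right' (f := fun w : (N × C × Z) × S =>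
        f (w.1.2.2, w.1.1, w.1.2.1, w.2)) (by fun_prop)
    calc ∫⁻ y, f (G (b, y.2.1.2), y.1, y.2.1.1, y.2.2) ∂(ν.prod ((κ.prod κ').prod σ))
        = ∫⁻ n, ∫⁻ c, ∫⁻ c', ∫⁻ s, f (G (b, c'), n, c, s) ∂σ ∂κ' ∂κ ∂ν := by
          rw [lintegral_prod _ (by fun_prop)]
          refine lintegral_congr fun n => ?_
          rw [lintegral_prod _ (by fun_prop), lintegral_prod]
          exact (Measurable.lintegral_prod_right' (f := fun w : (C × C') × S =>
            f (G (b, w.1.2), n, w.1.1, w.2)) (by fun_prop)).aemeasurable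
      _ = ∫⁻ n, ∫⁻ c, ∫⁻ z, ∫⁻ s, f (z, n, c, s) ∂σ ∂ζ ∂κ ∂ν := by simp_rw [hz]
      _ = ∫⁻ n, ∫⁻ z, ∫⁻ c, ∫⁻ s, f (z, n, c, s) ∂σ ∂κ ∂ζ ∂ν := by
          refine lintegral_congr fun n => ?_
          rw [lintegral_lintegral_swap]
          exact (hm1.comp (measurable_const.prodMk measurable_id)).aemeasurable
      _ = ∫⁻ z, ∫⁻ n, ∫⁻ c, ∫⁻ s, f (z, n, c, s) ∂σ ∂κ ∂ν ∂ζ := by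
          rw [lintegral_lintegral_swap]
          refine Measurable.aemeasurable ?_
          exact Measurable.lintegral_prod_right' (f := fun w : (N × Z) × C =>
            ∫⁻ s, f (w.1.2, w.1.1, w.2, s) ∂σ) (hm1.comp (g := fun w : N × C × Z =>
              ∫⁻ s, f (w.2.2, w.1, w.2.1, s) ∂σ) (f := fun w : (N × Z) × C => (w.1.1, w.2, w.1.2))
              (by fun_prop))
      _ = _ := by
          rw [lintegral_prod _ (by fun_prop)]
          refine lintegral_congr fun z => ?_
          rw [lintegral_prod _ (by fun_prop)]
          refine lintegral_congr fun n => ?_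
          rw [lintegral_prod _ (by fun_prop)]
  rw [lintegral_congr_ae hb]
  simp

end MeasureTools

/-! ### Random codebooks -/

section Codewords

variable {A : Type} [Fintype A] {In : A → Type} {M : A → ℕ}
  [∀ p, MeasurableSpace (In p)]

/-- The law of independent codebooks of independent codewords. -/
noncomputable def codebookLaw (M : A → ℕ) (ζ : ∀ p, Measure (In p)) :
    Measure (∀ p, Fin (M p) → In p) :=
  Measure.pi fun p => Measure.pi fun _ => ζ p

instance (ζ : ∀ p, Measure (In p)) [∀ p, IsProbabilityMeasure (ζ p)] :
    IsProbabilityMeasure (codebookLaw M ζ) := by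
  unfold codebookLaw; infer_instance

lemma map_codebookLaw (ζ : ∀ p, Measure (In p)) [∀ p, IsProbabilityMeasure (ζ p)]
    (msg : ∀ p, Fin (M p)) :
    (codebookLaw M ζ).map (fun c p => c p (msg p)) = Measure.pi ζ := by
  unfold codebookLaw
  have := Measure.pi_map_pi (μ := fun p => Measure.pi fun _ : Fin (M p) => ζ p)
    (f := fun p (c : Fin (M p) → In p) => c (msg p)) (fun p => (measurable_pi_apply _).aemeasurable)
  rw [this]
  congr 1
  funext p
  exact (measurePreserving_eval (fun _ : Fin (M p) => ζ p) (msg p)).map_eq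

/-- A codeword which is not sent is independent of those which are sent. -/
lemma map_codebookLaw_prod [DecidableEq A] [∀ p, Finite (In p)]
    [∀ p, DiscreteMeasurableSpace (In p)] (ζ : ∀ p, Measure (In p))
    [∀ p, IsProbabilityMeasure (ζ p)] (msg : ∀ p, Fin (M p)) {p : A} {m : Fin (M p)}
    (hm : m ≠ msg p) :
    (codebookLaw M ζ).map (fun c => (c p m, fun q => c q (msg q))) = (ζ p).prod (Measure.pi ζ) := by
  refine Measure.ext_of_singleton fun z => ?_
  obtain ⟨x, y⟩ := z
  rw [Measure.map_apply (by fun_prop) (measurableSet_singleton _), ← Set.singleton_prod_singleton,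
    Measure.prod_prod, Measure.pi_singleton]
  -- The preimage of a point is a box: the sent codewords and the codeword `m` of `p` are
  -- prescribed, all others are free. The casts transport `m` and `x` along `q = p`.
  let s : ∀ q, Fin (M q) → Set (In q) := fun q m' =>
    if m' = msg q then {y q} else {u | ∀ h : q = p, m' = h ▸ m → u = h ▸ x}
  have hpre : (fun c : ∀ q, Fin (M q) → In q => (c p m, fun q => c q (msg q))) ⁻¹'
      ({x} ×ˢ {y}) = Set.pi Set.univ fun q => Set.pi Set.univ fun m' => s q m' := by
    ext c
    simp only [Set.mem_preimage, Set.mem_prod, Set.mem_singleton_iff, Set.mem_pi, Set.mem_univ,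
      true_implies, s]
    constructor
    · rintro ⟨h1, h2⟩ q m'
      split_ifs with h
      · rw [h]; exact congrFun h2 q
      · rintro rfl rfl
        exact h1
    · intro h
      refine ⟨?_, funext fun q => ?_⟩
      · have := h p m
        rw [if_neg hm] at this
        exact this rfl rfl
      · simpa using h q (msg q)
  rw [hpre, codebookLaw, Measure.pi_pi]
  simp_rw [Measure.pi_pi]
  have hq : ∀ q, ∏ m', ζ q (s q m') = ζ q {y q} * if q = p then ζ p {x} else 1 := by
    intro q
    rw [← Finset.mul_prod_erase _ _ (Finset.mem_univ (msg q))]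
    congr 1
    · simp [s]
    · split_ifs with h
      · subst h
        rw [Finset.prod_eq_single_of_mem m (by simpa using hm)]
        · simp [s, hm]
        · intro m' hm' hne
          have := Finset.ne_of_mem_erase hm'
          simp [s, this, hne]
      · refine Finset.prod_eq_one fun m' hm' => ?_
        have := Finset.ne_of_mem_erase hm'
        simp [s, this, h]
  simp_rw [hq, Finset.prod_mul_distrib]
  simp [mul_comm]

end Codewords

/-! ### The law of the system under random coding -/

section RandomCoding

variable {U : Type} {A : Finset (UserPair U)} {In Out : A → Type} {M : A → ℕ}
  {𝒳 𝒴 : UserPair U → Type} {I O : U → Type} {C S : Type}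
  [∀ p, MeasurableSpace (In p)] [∀ p, MeasurableSpace (Out p)]
  [∀ p, MeasurableSpace (𝒳 p)] [∀ p, MeasurableSpace (𝒴 p)]
  [∀ i, MeasurableSpace (I i)] [∀ i, MeasurableSpace (O i)] [MeasurableSpace C]
  [MeasurableSpace S]

section WithCodebook

variable [∀ p, Finite (In p)] [∀ p, DiscreteMeasurableSpace (In p)]
  [∀ p, Finite (Out p)] [∀ p, DiscreteMeasurableSpace (Out p)]

/-- The message modem which looks up codewords in codebooks known to all users, sends them by the
modem `h`, and decodes the output of `h` by `δ`. -/
noncomputable def Modem.withCodebook {i : U} (h : Modem A In Out 𝒳 𝒴 I O C i)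
    (δ : ∀ p, Out p → (Fin (M p) → In p) → Fin (M p)) :
    Modem A (fun p => Fin (M p)) (fun p => Fin (M p)) 𝒳 𝒴 I O (C × ∀ p, Fin (M p) → In p) i where
  step k := (h.step k).comap (fun v => (fun p => v.2.2.1.2 p.1 (v.1 p), v.2.1, v.2.2.1.1, v.2.2.2))
    ((measurable_pi_lambda _ fun p =>
      (Measurable.of_discrete (f := fun z : (Fin (M p.1) → In p.1) × Fin (M p.1) => z.1 z.2)).comp
        (g := fun z : (Fin (M p.1) → In p.1) × Fin (M p.1) => z.1 z.2)
        (f := fun v : ModemView A (fun p => Fin (M p)) 𝒳 𝒴 I O (C × ∀ p, Fin (M p) → In p) i k =>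
          (v.2.2.1.2 p.1, v.1 p)) (by fun_prop)).prodMk (by fun_prop))
  markov _ := inferInstance
  read p w := δ p.1 (h.read p (w.1, w.2.1)) (w.2.2 p.1)
  measurable_read p :=
    (Measurable.of_discrete (f := fun z : Out p.1 × (Fin (M p.1) → In p.1) => δ p.1 z.1 z.2)).comp
      (((h.measurable_read p).comp (by fun_prop)).prodMk (by fun_prop))

end WithCodebook

/-- Replaces the messages by the codewords. -/
def substituteCodewords
    (w : Primitive A (fun p => Fin (M p)) 𝒳 (C × ∀ p, Fin (M p) → In p) S) :
    Primitive A In 𝒳 C S :=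
  (fun p => w.2.2.1.2 p (w.1 p), w.2.1, w.2.2.1.1, w.2.2.2)

lemma measurable_codewords [∀ p, Finite (In p)] [∀ p, DiscreteMeasurableSpace (In p)] :
    Measurable fun (w : (∀ p, Fin (M p)) × ∀ p, Fin (M p) → In p) (p : A) => w.2 p (w.1 p) :=
  Measurable.of_discrete

lemma measurable_substituteCodewords [∀ p, Finite (In p)] [∀ p, DiscreteMeasurableSpace (In p)] :
    Measurable (substituteCodewords (A := A) (In := In) (M := M) (𝒳 := 𝒳) (C := C) (S := S)) :=
  (measurable_codewords.comp (measurable_fst.prodMk (by fun_prop))).prodMk (by fun_prop)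

lemma measurable_unaffected :
    Measurable (unaffected : Realization A In 𝒳 𝒴 I O C S → _) := by
  unfold unaffected reproduction mediumInput mediumOutput
  fun_prop

lemma measurable_decoded (h : ∀ i, Modem A In Out 𝒳 𝒴 I O C i) (p : A) :
    Measurable (decoded h p : Realization A In 𝒳 𝒴 I O C S → _) := by
  unfold decoded reproduction
  exact ((h p.1.dst).measurable_read ⟨p, rfl⟩).comp (by fun_prop)

variable [Fintype U]

/-- Messages and codebooks influence the emissions only through the codewords sent, which is the
hypothesis of `run_apply_of_comap`. -/
lemma systemStep_withCodebook [∀ p, Finite (In p)] [∀ p, DiscreteMeasurableSpace (In p)]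
    [∀ p, Finite (Out p)] [∀ p, DiscreteMeasurableSpace (Out p)]
    (h : ∀ i, Modem A In Out 𝒳 𝒴 I O C i) (m : Medium I O S)
    (δ : ∀ p, Out p → (Fin (M p) → In p) → Fin (M p)) (k : ℕ)
    (w : Primitive A (fun p => Fin (M p)) 𝒳 (C × ∀ p, Fin (M p) → In p) S)
    (s : Fin k → Signal 𝒴 I O) :
    systemStep (fun i => (h i).withCodebook δ) m k (w, s) =
      systemStep h m k (substituteCodewords w, s) := by
  simp only [systemStep, Kernel.prod_apply]
  rfl

lemma systemStep_withSourceCode {Msg : A → Type} [∀ p, MeasurableSpace (Msg p)]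
    [∀ p, DiscreteMeasurableSpace (Msg p)] [∀ p, DiscreteMeasurableSpace (In p)]
    (g : ∀ i, Modem A Msg Msg 𝒳 𝒴 I O C i) (enc : ∀ p, In p → Msg p) (dec : ∀ p, Msg p → Out p)
    (m : Medium I O S) (k : ℕ) (w : Primitive A In 𝒳 C S) (s : Fin k → Signal 𝒴 I O) :
    systemStep (fun i => (g i).withSourceCode enc dec) m k (w, s) =
      systemStep g m k ((fun p => enc p (w.1 p), w.2), s) := by
  simp only [systemStep, Kernel.prod_apply]
  rfl

variable [DecidableEq U]

section Laws

variable (β : Measure (∀ p, In p)) [IsProbabilityMeasure β]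
  (ν : ∀ p : {p : UserPair U // p ∉ A}, Measure (ℤ → 𝒳 p.1)) [∀ p, IsProbabilityMeasure (ν p)]
  (κ : Measure C) [IsProbabilityMeasure κ] (m : Medium I O S)

/-- The data of the pairs in `A` have their prescribed law. -/
lemma map_systemLaw_data (h : ∀ i, Modem A In Out 𝒳 𝒴 I O C i) :
    (systemLaw h m β ν κ).map (fun w => w.1.1) = β := by
  have h1 : (systemLaw h m β ν κ).map Prod.fst = β.prod ((Measure.pi ν).prod (κ.prod m.init)) :=
    Measure.fst_compProd _ _
  have h2 := congrArg (Measure.map Prod.fst) h1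
  rw [Measure.map_map measurable_fst measurable_fst] at h2
  refine h2.trans ?_
  change Measure.fst _ = _
  rw [Measure.fst_prod]

/-- The law of the system is the mixture of its laws for deterministic data. -/
lemma systemLaw_apply_eq_lintegral (h : ∀ i, Modem A In Out 𝒳 𝒴 I O C i)
    {E : Set (Realization A In 𝒳 𝒴 I O C S)} (hE : MeasurableSet E) :
    systemLaw h m β ν κ E = ∫⁻ b, systemLaw h m (Measure.dirac b) ν κ E ∂β := by
  unfold systemLaw
  have hmeas := Kernel.measurable_kernel_prodMk_left (κ := run (systemStep h m)) hE
  rw [Measure.compProd_apply hE, lintegral_prod _ hmeas.aemeasurable]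
  refine lintegral_congr fun b => ?_
  rw [Measure.compProd_apply hE, Measure.dirac_prod, lintegral_map hmeas (by fun_prop)]

/-- Source coding of the data. -/
lemma map_systemLaw_withSourceCode {Msg : A → Type} [∀ p, MeasurableSpace (Msg p)]
    [∀ p, DiscreteMeasurableSpace (Msg p)] [∀ p, DiscreteMeasurableSpace (In p)]
    (g : ∀ i, Modem A Msg Msg 𝒳 𝒴 I O C i) (enc : ∀ p, In p → Msg p) (dec : ∀ p, Msg p → Out p) :
    (systemLaw (fun i => (g i).withSourceCode enc dec) m β ν κ).map
      (fun w => (((fun p => enc p (w.1.1 p)), w.1.2), w.2)) =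
      systemLaw g m (β.map fun b p => enc p (b p)) ν κ := by
  have henc : Measurable fun (b : ∀ p, In p) p => enc p (b p) :=
    measurable_pi_lambda _ fun p => Measurable.of_discrete.comp (measurable_pi_apply p)
  have hφ : Measurable fun w : Primitive A In 𝒳 C S => ((fun p => enc p (w.1 p)), w.2) :=
    (henc.comp measurable_fst).prodMk measurable_snd
  have key := map_compProd_of_comap (β.prod ((Measure.pi ν).prod (κ.prod m.init)))
    (run (systemStep (fun i => (g i).withSourceCode enc dec) m)) (run (systemStep g m)) hφ
    (run_apply_of_comap hφ _ _ fun k x s => systemStep_withSourceCode g enc dec m k x s)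
  refine key.trans ?_
  unfold systemLaw
  congr 1
  have := Measure.map_prod_map β ((Measure.pi ν).prod (κ.prod m.init)) henc measurable_id
  rw [Measure.map_id] at this
  exact this.symm

variable [∀ p, Finite (In p)] [∀ p, DiscreteMeasurableSpace (In p)]
  [∀ p, Finite (Out p)] [∀ p, DiscreteMeasurableSpace (Out p)]
  (ζ : ∀ p, Measure (In p)) [∀ p, IsProbabilityMeasure (ζ p)]

/-- With random codebooks, codewords have the law of the data for which `h` was made. -/
lemma map_systemLaw_withCodebook (b : Measure (∀ p, Fin (M p))) [IsProbabilityMeasure b]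
    (h : ∀ i, Modem A In Out 𝒳 𝒴 I O C i) (δ : ∀ p, Out p → (Fin (M p) → In p) → Fin (M p)) :
    (systemLaw (fun i => (h i).withCodebook δ) m b ν (κ.prod (codebookLaw M ζ))).map
      (Prod.map substituteCodewords id) = systemLaw h m (Measure.pi ζ) ν κ := by
  have key := map_compProd_of_comap
    (b.prod ((Measure.pi ν).prod ((κ.prod (codebookLaw M ζ)).prod m.init)))
    (run (systemStep (fun i => (h i).withCodebook δ) m)) (run (systemStep h m))
    measurable_substituteCodewords
    (run_apply_of_comap measurable_substituteCodewords _ _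
      fun k x s => systemStep_withCodebook h m δ k x s)
  refine key.trans ?_
  unfold systemLaw
  congr 1
  exact map_prod_substitute b (Measure.pi ν) κ (codebookLaw M ζ) m.init (Measure.pi ζ)
    measurable_codewords (Eventually.of_forall fun msg => map_codebookLaw ζ msg)

/-- The codewords of other messages are independent of the system. -/
lemma map_systemLaw_withCodebook_prod (msg : ∀ p, Fin (M p))
    (h : ∀ i, Modem A In Out 𝒳 𝒴 I O C i) (δ : ∀ p, Out p → (Fin (M p) → In p) → Fin (M p))
    {p : A} {m' : Fin (M p)} (hm' : m' ≠ msg p) :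
    (systemLaw (fun i => (h i).withCodebook δ) m (Measure.dirac msg) ν
      (κ.prod (codebookLaw M ζ))).map
      (fun w => (w.1.2.2.1.2 p m', substituteCodewords w.1, w.2)) =
      (ζ p).prod (systemLaw h m (Measure.pi ζ) ν κ) := by
  refine map_compProd_eq_prod
    ((Measure.dirac msg).prod ((Measure.pi ν).prod ((κ.prod (codebookLaw M ζ)).prod m.init)))
    (run (systemStep (fun i => (h i).withCodebook δ) m)) _ (run (systemStep h m)) (ζ p)
    measurable_substituteCodewords (u := fun w => w.2.2.1.2 p m') (by fun_prop)
    (run_apply_of_comap measurable_substituteCodewords _ _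
      fun k x s => systemStep_withCodebook h m δ k x s) ?_
  have hG : Measurable fun w : (∀ p, Fin (M p)) × ∀ p, Fin (M p) → In p =>
      (w.2 p m', fun q => w.2 q (w.1 q)) :=
    Measurable.of_discrete
  have key := map_prod_substitute (Measure.dirac msg) (Measure.pi ν) κ (codebookLaw M ζ) m.init
    ((ζ p).prod (Measure.pi ζ)) hG
    -- Independence holds only for messages with `m' ≠ msg p`; under the Dirac law of the data this
    -- is all that is asked.
    (by rw [ae_dirac_eq]; exact map_codebookLaw_prod ζ msg hm')
  rw [← (measurePreserving_prodAssoc (ζ p) (Measure.pi ζ)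
    ((Measure.pi ν).prod (κ.prod m.init))).map_eq, ← key, Measure.map_map]
  · rfl
  · exact MeasurableEquiv.prodAssoc.measurable
  · exact (hG.comp (measurable_fst.prodMk (by fun_prop))).prodMk (by fun_prop)

end Laws

end RandomCoding

/-! ### Error bounds for decoding and for separate source coding -/

section Decoder

open Classical in
/-- Decodes to a message whose codeword matches the received block, if there is one. -/
noncomputable def matchDecoder {α γ : Type} {M : ℕ} (W : γ → Set α) (m₀ : Fin M) (y : γ)
    (c : Fin M → α) : Fin M :=
  if h : ∃ m, c m ∈ W y then h.choose else m₀

lemma matchDecoder_eq {α γ : Type} {M : ℕ} {W : γ → Set α} {m₀ : Fin M} {y : γ} {c : Fin M → α}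
    {m : Fin M} (hm : c m ∈ W y) (hne : ∀ m', m' ≠ m → c m' ∉ W y) :
    matchDecoder W m₀ y c = m := by
  have hex : ∃ m, c m ∈ W y := ⟨m, hm⟩
  rw [matchDecoder, dif_pos hex]
  by_contra h
  exact hne _ h hex.choose_spec

variable {U : Type} {A : Finset (UserPair U)} {In Out : A → Type} {M : A → ℕ}
  {𝒳 𝒴 : UserPair U → Type} {I O : U → Type} {C S : Type}
  [∀ p, MeasurableSpace (In p)] [∀ p, MeasurableSpace (Out p)]
  [∀ p, MeasurableSpace (𝒳 p)] [∀ p, MeasurableSpace (𝒴 p)]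
  [∀ i, MeasurableSpace (I i)] [∀ i, MeasurableSpace (O i)] [MeasurableSpace C]
  [MeasurableSpace S] [Fintype U] [DecidableEq U]
  (ν : ∀ p : {p : UserPair U // p ∉ A}, Measure (ℤ → 𝒳 p.1)) [∀ p, IsProbabilityMeasure (ν p)]
  (κ : Measure C) [IsProbabilityMeasure κ] (m : Medium I O S)
  [∀ p, Finite (In p)] [∀ p, DiscreteMeasurableSpace (In p)]

lemma systemLaw_dirac_data_ne (h : ∀ i, Modem A In Out 𝒳 𝒴 I O C i) (b : ∀ p, In p) :
    systemLaw h m (Measure.dirac b) ν κ {w | w.1.1 ≠ b} = 0 := by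
  have h1 : (systemLaw h m (Measure.dirac b) ν κ).map (fun w => w.1.1) {b}ᶜ =
      Measure.dirac b {b}ᶜ := by
    rw [map_systemLaw_data]
  rw [Measure.map_apply (by fun_prop) (measurableSet_singleton b).compl,
    Measure.dirac_apply' _ (measurableSet_singleton b).compl] at h1
  exact h1.trans (by simp)

/-- Random coding bound for the maximal error probability. -/
lemma systemLaw_withCodebook_error_le
    [∀ p, Finite (Out p)] [∀ p, DiscreteMeasurableSpace (Out p)]
    (ζ : ∀ p, Measure (In p)) [∀ p, IsProbabilityMeasure (ζ p)]
    (h : ∀ i, Modem A In Out 𝒳 𝒴 I O C i) (W : ∀ p, Out p → Set (In p)) (m₀ msg : ∀ p, Fin (M p))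
    (p : A) :
    systemLaw (fun i => (h i).withCodebook fun q => matchDecoder (W q) (m₀ q)) m
      (Measure.dirac msg) ν (κ.prod (codebookLaw M ζ))
      {w | decoded (fun i => (h i).withCodebook fun q => matchDecoder (W q) (m₀ q)) p w ≠ msg p} ≤
    systemLaw h m (Measure.pi ζ) ν κ {w | w.1.1 p ∉ W p (decoded h p w)} +
      M p * ⨆ y, ζ p (W p y) := by
  set g := fun i => (h i).withCodebook fun q => matchDecoder (W q) (m₀ q) with hg
  set Λ := systemLaw g m (Measure.dirac msg) ν (κ.prod (codebookLaw M ζ)) with hΛ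
  have hmatch : MeasurableSet {z : In p × Out p | z.1 ∈ W p z.2} := MeasurableSet.of_discrete
  have hdec := measurable_decoded (S := S) h p
  let bad : Set (Realization A In 𝒳 𝒴 I O C S) := {w | w.1.1 p ∉ W p (decoded h p w)}
  have hbad : MeasurableSet bad :=
    (show Measurable fun w : Realization A In 𝒳 𝒴 I O C S => (w.1.1 p, decoded h p w) from
      (by fun_prop : Measurable fun w : Realization A In 𝒳 𝒴 I O C S => w.1.1 p).prodMk hdec)
      hmatch.compl
  let conf : Fin (M p) → Set (Realization A (fun p => Fin (M p)) 𝒳 𝒴 I O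
      (C × ∀ p, Fin (M p) → In p) S) := fun m' =>
    {w | w.1.2.2.1.2 p m' ∈ W p (decoded h p (substituteCodewords w.1, w.2))}
  -- Apart from a null event, decoding fails only if the sent codeword does not match or another
  -- codeword does.
  have hsub : {w | decoded g p w ≠ msg p} ⊆ {w | w.1.1 ≠ msg} ∪
      (Prod.map substituteCodewords id ⁻¹' bad ∪ ⋃ m' ∈ Finset.univ.erase (msg p), conf m') := by
    intro w hw
    by_contra hcon
    simp only [Set.mem_union, not_or, Set.mem_iUnion, not_exists] at hcon
    obtain ⟨h1, h2, h3⟩ := hcon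
    have h1' : w.1.1 = msg := by simpa using h1
    have h2' : w.1.2.2.1.2 p (w.1.1 p) ∈ W p (decoded h p (substituteCodewords w.1, w.2)) := by
      by_contra hb
      exact h2 hb
    rw [h1'] at h2'
    exact hw (matchDecoder_eq h2' fun m' hm' hc =>
      h3 m' (Finset.mem_erase.2 ⟨hm', Finset.mem_univ _⟩) hc)
  have h1 : Λ (Prod.map substituteCodewords id ⁻¹' bad) =
      systemLaw h m (Measure.pi ζ) ν κ bad := by
    rw [← map_systemLaw_withCodebook ν κ m ζ (Measure.dirac msg) h
      fun q => matchDecoder (W q) (m₀ q), Measure.map_apply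
      (measurable_substituteCodewords.prodMap measurable_id) hbad]
  have h2 : ∀ m' ∈ Finset.univ.erase (msg p), Λ (conf m') ≤ ⨆ y, ζ p (W p y) := by
    intro m' hm'
    have hset : MeasurableSet {z : In p × Realization A In 𝒳 𝒴 I O C S |
        z.1 ∈ W p (decoded h p z.2)} :=
      (measurable_fst.prodMk (hdec.comp measurable_snd)) hmatch
    have key := map_systemLaw_withCodebook_prod ν κ m ζ msg h
      (fun q => matchDecoder (W q) (m₀ q)) (Finset.ne_of_mem_erase hm')
    have hpre : Λ (conf m') = ((ζ p).prod (systemLaw h m (Measure.pi ζ) ν κ))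
        {z | z.1 ∈ W p (decoded h p z.2)} := by
      rw [← key, Measure.map_apply _ hset]
      · rfl
      · exact Measurable.prodMk (by fun_prop)
          ((measurable_substituteCodewords.comp measurable_fst).prodMk measurable_snd)
    have : IsProbabilityMeasure (systemLaw h m (Measure.pi ζ) ν κ) := by
      unfold systemLaw; infer_instance
    -- Condition on the system: the decoded block is then fixed, and the other codeword is still
    -- fresh with law `ζ p`.
    rw [hpre, Measure.prod_apply_symm hset]
    calc _ ≤ ∫⁻ _w, (⨆ y, ζ p (W p y)) ∂(systemLaw h m (Measure.pi ζ) ν κ) :=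
          lintegral_mono fun w => le_iSup (fun y => ζ p (W p y)) (decoded h p w)
      _ = _ := by simp
  calc Λ {w | decoded g p w ≠ msg p}
      ≤ Λ {w | w.1.1 ≠ msg} + (Λ (Prod.map substituteCodewords id ⁻¹' bad) +
        Λ (⋃ m' ∈ Finset.univ.erase (msg p), conf m')) :=
        (measure_mono hsub).trans ((measure_union_le _ _).trans
          (add_le_add_right (measure_union_le _ _) _))
    _ ≤ 0 + (systemLaw h m (Measure.pi ζ) ν κ bad + M p * ⨆ y, ζ p (W p y)) := by
        refine add_le_add (systemLaw_dirac_data_ne ν _ m g msg).le (add_le_add h1.le ?_)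
        refine (measure_biUnion_finset_le _ _).trans ((Finset.sum_le_sum h2).trans ?_)
        rw [Finset.sum_const, nsmul_eq_mul]
        gcongr
        simp
    _ = _ := by rw [zero_add]

/-- Separate source coding errs at most by the maximal error of the messages plus the excess
distortion of the source code. -/
lemma systemLaw_withSourceCode_distortion_le {Msg : A → Type} [∀ p, MeasurableSpace (Msg p)]
    [∀ p, Finite (Msg p)] [∀ p, DiscreteMeasurableSpace (Msg p)]
    (β : Measure (∀ p, In p)) [IsProbabilityMeasure β]
    (g : ∀ i, Modem A Msg Msg 𝒳 𝒴 I O C i) (enc : ∀ p, In p → Msg p) (dec : ∀ p, Msg p → Out p)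
    (p : A) (excess : Set (In p × Out p)) :
    systemLaw (fun i => (g i).withSourceCode enc dec) m β ν κ
      {w | (w.1.1 p, decoded (fun i => (g i).withSourceCode enc dec) p w) ∈ excess} ≤
    (⨆ msg, systemLaw g m (Measure.dirac msg) ν κ {w | decoded g p w ≠ msg p}) +
      β {b | (b p, dec p (enc p (b p))) ∈ excess} := by
  set Λ := systemLaw (fun i => (g i).withSourceCode enc dec) m β ν κ with hΛ
  let ψ : Realization A In 𝒳 𝒴 I O C S → Realization A Msg 𝒳 𝒴 I O C S :=
    fun w => (((fun p => enc p (w.1.1 p)), w.1.2), w.2)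
  have hψ : Measurable ψ := by
    have henc : Measurable fun (b : ∀ p, In p) p => enc p (b p) := Measurable.of_discrete
    exact ((henc.comp (by fun_prop)).prodMk (by fun_prop)).prodMk (by fun_prop)
  let wrong : Set (Realization A Msg 𝒳 𝒴 I O C S) := {w | decoded g p w ≠ w.1.1 p}
  have hwrong : MeasurableSet wrong :=
    ((measurable_decoded g p).prodMk
      (by fun_prop : Measurable fun w : Realization A Msg 𝒳 𝒴 I O C S => w.1.1 p))
      (MeasurableSet.of_discrete (s := {z : Msg p × Msg p | z.1 ≠ z.2}))
  have hsub : {w | (w.1.1 p, decoded (fun i => (g i).withSourceCode enc dec) p w) ∈ excess} ⊆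
      ψ ⁻¹' wrong ∪ (fun w => w.1.1) ⁻¹' {b | (b p, dec p (enc p (b p))) ∈ excess} := by
    intro w hw
    by_cases hc : decoded g p (ψ w) = enc p (w.1.1 p)
    · right
      have : decoded (fun i => (g i).withSourceCode enc dec) p w = dec p (enc p (w.1.1 p)) := by
        rw [← hc]; rfl
      have hw' : (w.1.1 p, decoded (fun i => (g i).withSourceCode enc dec) p w) ∈ excess := hw
      rw [this] at hw'
      exact hw'
    · exact Or.inl hc
  have : IsProbabilityMeasure (β.map fun b p => enc p (b p)) :=
    Measure.isProbabilityMeasure_map (Measurable.of_discrete).aemeasurable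
  refine (measure_mono hsub).trans ((measure_union_le _ _).trans (add_le_add ?_ ?_))
  · rw [← Measure.map_apply hψ hwrong, map_systemLaw_withSourceCode β ν κ m g enc dec,
      systemLaw_apply_eq_lintegral _ ν κ m g hwrong]
    -- The maximal error criterion makes the law of the encoded messages irrelevant.
    calc _ ≤ ∫⁻ _b, (⨆ msg, systemLaw g m (Measure.dirac msg) ν κ {w | decoded g p w ≠ msg p})
          ∂(β.map fun b p => enc p (b p)) := by
          refine lintegral_mono fun b => ?_
          refine le_trans ?_ (le_iSup (fun msg : ∀ p, Msg p =>
            systemLaw g m (Measure.dirac msg) ν κ {w | decoded g p w ≠ msg p}) b)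
          have hs : wrong ⊆ {w | decoded g p w ≠ b p} ∪ {w | w.1.1 ≠ b} := by
            intro w hw
            by_cases hb : w.1.1 = b
            · left
              rw [← hb]; exact hw
            · exact Or.inr hb
          refine (measure_mono hs).trans ((measure_union_le _ _).trans ?_)
          rw [systemLaw_dirac_data_ne, add_zero]
      _ = _ := by simp
  · rw [← Measure.map_apply (by fun_prop) MeasurableSet.of_discrete, map_systemLaw_data]

end Decoder

/-! ### Assembly of the separation theorem -/

section Main

variable {U : Type} [Fintype U] [DecidableEq U] {A : Finset (UserPair U)}
  {𝒳 𝒴 : UserPair U → Type} {I O : U → Type} {C : ℕ → Type} {S : Type}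
  [∀ p, MeasurableSpace (𝒳 p)] [∀ p, MeasurableSpace (𝒴 p)]
  [∀ i, MeasurableSpace (I i)] [∀ i, MeasurableSpace (O i)] [∀ n, MeasurableSpace (C n)]
  [MeasurableSpace S]

/-- The law of a source block in the interconnected system. -/
lemma sourceLaw_apply_block {C : Type} [MeasurableSpace C] {n : ℕ}
    (h : ∀ i, SourceModem A 𝒳 𝒴 I O C n i) (m : Medium I O S)
    (μ : ∀ p : A, Measure (𝒳 p.1)) [∀ p, IsProbabilityMeasure (μ p)]
    (ν : ∀ p : {p : UserPair U // p ∉ A}, Measure (ℤ → 𝒳 p.1)) [∀ p, IsProbabilityMeasure (ν p)]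
    (κ : Measure C) [IsProbabilityMeasure κ] (p : A) {E : Set (Fin n → 𝒳 p.1)}
    (hE : MeasurableSet E) :
    sourceLaw h m μ ν κ {w | w.1.1 p ∈ E} = (Measure.pi fun _ : Fin n => μ p) E := by
  have hp : Measurable fun b : ∀ p : A, Fin n → 𝒳 p.1 => b p := measurable_pi_apply p
  rw [← (measurePreserving_eval (fun p : A => Measure.pi fun _ : Fin n => μ p) p).map_eq,
    ← map_systemLaw_data (Measure.pi fun p : A => Measure.pi fun _ : Fin n => μ p) ν κ m h,
    Measure.map_map hp (by fun_prop), Measure.map_apply (hp.comp (by fun_prop)) hE]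
  rfl

/-- A source which is communicated to within `D` over some medium has a block-by-block reproduction
to within `D`. -/
lemma CommunicatesWithin.exists_reproduction [∀ p, Finite (𝒳 p)]
    [∀ p, DiscreteMeasurableSpace (𝒳 p)] [∀ p, Finite (𝒴 p)]
    {h : ∀ n i, SourceModem A 𝒳 𝒴 I O (C n) n i} {m : Medium I O S}
    {μ : ∀ p : A, Measure (𝒳 p.1)} [∀ p, IsProbabilityMeasure (μ p)]
    {ν : ∀ p : {p : UserPair U // p ∉ A}, Measure (ℤ → 𝒳 p.1)} [∀ p, IsProbabilityMeasure (ν p)]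
    {κ : ∀ n, Measure (C n)} [∀ n, IsProbabilityMeasure (κ n)] {p : A} [Nonempty (𝒴 p.1)]
    {d : 𝒳 p.1 → 𝒴 p.1 → ℝ≥0} {D : ℝ} (hc : CommunicatesWithin h m μ ν κ p d D) :
    ∃ f : ∀ n, (Fin n → 𝒳 p.1) → Fin n → 𝒴 p.1,
      Tendsto (fun n => (Measure.pi fun _ : Fin n => μ p) {x | D < avgDistortion d x (f n x)})
        atTop (𝓝 0) := by
  -- The reproduction of least distortion is never worse than the decoded block.
  have hmin : ∀ n (x : Fin n → 𝒳 p.1), ∃ y : Fin n → 𝒴 p.1,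
      ∀ y', avgDistortion d x y ≤ avgDistortion d x y' := fun n x => Finite.exists_min _
  choose f hf using hmin
  refine ⟨f, tendsto_of_tendsto_of_tendsto_of_le_of_le tendsto_const_nhds hc
    (fun _ => zero_le) fun n => ?_⟩
  dsimp only
  rw [← sourceLaw_apply_block (h n) m μ ν (κ n) p MeasurableSet.of_discrete]
  exact measure_mono fun w hw => lt_of_lt_of_le (show D < _ from hw) (hf n _ _)

end Main

end UnknownNetwork

theorem mainTheorem1 {U : Type} [Fintype U] [DecidableEq U]
    -- finite alphabets of the sources, their reproductions, the medium inputs and medium outputs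
    {𝒳 𝒴 : UserPair U → Type} {I O : U → Type}
    [∀ p, Finite (𝒳 p)] [∀ p, MeasurableSpace (𝒳 p)] [∀ p, DiscreteMeasurableSpace (𝒳 p)]
    [∀ p, Finite (𝒴 p)] [∀ p, MeasurableSpace (𝒴 p)] [∀ p, DiscreteMeasurableSpace (𝒴 p)]
    [∀ i, Finite (I i)] [∀ i, MeasurableSpace (I i)] [∀ i, DiscreteMeasurableSpace (I i)]
    [∀ i, Finite (O i)] [∀ i, MeasurableSpace (O i)] [∀ i, DiscreteMeasurableSpace (O i)]
    -- common randomness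
    {C : ℕ → Type} [∀ n, MeasurableSpace (C n)] (κ : ∀ n, Measure (C n))
    [∀ n, IsProbabilityMeasure (κ n)]
    -- the marginals of the i.i.d. sources in `A`, the laws of the other sources
    (A : Finset (UserPair U)) (μ : ∀ p : A, Measure (𝒳 p.1)) [∀ p, IsProbabilityMeasure (μ p)]
    (ν : ∀ p : {p : UserPair U // p ∉ A}, Measure (ℤ → 𝒳 p.1)) [∀ p, IsProbabilityMeasure (ν p)]
    (d : ∀ p : A, 𝒳 p.1 → 𝒴 p.1 → ℝ≥0) (D D' : A → ℝ) (hD : ∀ p, D p < D' p)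
    (hR : ∀ p, rateDistortion (μ p) (d p) (D' p) < rateDistortion (μ p) (d p) (D p))
    -- the given modems
    (h : ∀ n i, SourceModem A 𝒳 𝒴 I O (C n) n i) :
    ∃ (C' : ℕ → Type) (_ : ∀ n, MeasurableSpace (C' n)) (κ' : ∀ n, Measure (C' n))
      (_ : ∀ n, IsProbabilityMeasure (κ' n)) (R : A → ℝ≥0)
      (enc : ∀ (p : A) (n : ℕ), (Fin n → 𝒳 p.1) → Fin (msgCount (R p) n))
      (dec : ∀ (p : A) (n : ℕ), Fin (msgCount (R p) n) → (Fin n → 𝒴 p.1))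
      (g : ∀ n i, MessageModem A 𝒳 𝒴 I O (C n × C' n) (fun p => msgCount (R p) n) i)
      (h' : ∀ n i, SourceModem A 𝒳 𝒴 I O (C n × C' n) n i),
      -- source coding to within `D'`, at a rate between `R(D')` and `R(D)`
      (∀ p, rateDistortion (μ p) (d p) (D' p) < R p ∧ R p < rateDistortion (μ p) (d p) (D p)) ∧
      (∀ p, CompressesWithin (μ p) (d p) (D' p) (enc p) (dec p)) ∧
      -- the new modems have the separation architecture
      (∀ n i, h' n i = (g n i).withSourceCode (fun p => enc p n) (fun p => dec p n)) ∧
      -- the modem of a user which is in no pair of `A` is not changed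
      (∀ n i, (∀ p ∈ A, p.src ≠ i ∧ p.dst ≠ i) → ∀ k b x c c' o y,
        (h' n i).step k (b, x, (c, c'), o, y) = (h n i).step k (b, x, c, o, y)) ∧
      -- the new modems do not depend on the medium: the following holds for all media
      ∀ (S : Type) [MeasurableSpace S] (m : Medium I O S),
        (∀ p, CommunicatesWithin h m μ ν κ p (d p) (D p)) →
        -- the messages are communicated reliably
        (∀ p, CommunicatesReliably g m ν (fun n => (κ n).prod (κ' n)) p) ∧
        -- end to end, the sources in `A` are communicated to within `D'`
        (∀ p, CommunicatesWithin h' m μ ν (fun n => (κ n).prod (κ' n)) p (d p) (D' p)) ∧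
        -- energy and bandwidth use, which are functions of the law of the medium input of a user
        (∀ n i, (sourceLaw (h' n) m μ ν ((κ n).prod (κ' n))).map (mediumInput i) =
          (sourceLaw (h n) m μ ν (κ n)).map (mediumInput i)) ∧
        -- every other source is received as before, jointly in distribution
        (∀ n, (sourceLaw (h' n) m μ ν ((κ n).prod (κ' n))).map unaffected =
          (sourceLaw (h n) m μ ν (κ n)).map unaffected) := by
  classical
  -- rates and source codes
  have hrate : ∀ p, ∃ R : ℝ≥0, rateDistortion (μ p) (d p) (D' p) < R ∧
      R < rateDistortion (μ p) (d p) (D p) := fun p => ENNReal.lt_iff_exists_nnreal_btwn.1 (hR p)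
  choose R hR' hRD using hrate
  choose enc dec hcode using fun p => isAchievableRate_of_rateDistortion_lt (hR' p)
  -- A decoded block of length 1 supplies a letter.
  have hne : ∀ p : A, Nonempty (𝒴 p.1) := fun p => ⟨dec p 1 ⟨0, msgCount_pos _ _⟩ 0⟩
  choose T hT hpack using fun p => exists_packing (μ p) (d p) (D p) (hRD p)
  -- random codebooks, and decoding by the distortion to typical codewords
  let ζ : ∀ (n : ℕ) (p : A), Measure (Fin n → 𝒳 p.1) := fun n p => Measure.pi fun _ => μ p
  let W : ∀ (n : ℕ) (p : A), (Fin n → 𝒴 p.1) → Set (Fin n → 𝒳 p.1) := fun n p y =>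
    T p n ∩ {x | avgDistortion (d p) x y ≤ D p}
  let g : ∀ n i, MessageModem A 𝒳 𝒴 I O
      (C n × ∀ p : A, Fin (msgCount (R p) n) → Fin n → 𝒳 p.1) (fun p => msgCount (R p) n) i :=
    fun n i => (h n i).withCodebook fun p => matchDecoder (W n p) ⟨0, msgCount_pos _ _⟩
  refine ⟨fun n => ∀ p : A, Fin (msgCount (R p) n) → Fin n → 𝒳 p.1, fun n => inferInstance,
    fun n => codebookLaw (fun p => msgCount (R p) n) (ζ n), fun n => inferInstance, R, enc, dec, g,
    fun n i => (g n i).withSourceCode (fun p => enc p n) (fun p => dec p n),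
    fun p => ⟨hR' p, hRD p⟩, hcode, fun _ _ => rfl, ?_, ?_⟩
  -- Such a user has no codewords to look up: the data components are functions on an empty type.
  · intro n i hi k b x c c' o y
    change (h n i).step k (_, x, c, o, y) = _
    congr 2
    funext p
    exact absurd p.2 (hi p.1.1 p.1.2).1
  intro S _ m hcomm
  have hrel : ∀ p, CommunicatesReliably g m ν
      (fun n => (κ n).prod (codebookLaw (fun p => msgCount (R p) n) (ζ n))) p := by
    intro p
    obtain ⟨f, hf⟩ := (hcomm p).exists_reproduction
    -- The three sources of error: an atypical codeword, excess distortion of the sent codeword, and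
    -- a match with a wrong codeword.
    have hlim := ((hT p).add (hcomm p)).add (hpack p f hf)
    rw [add_zero, add_zero] at hlim
    refine tendsto_of_tendsto_of_tendsto_of_le_of_le tendsto_const_nhds hlim
      (fun _ => zero_le) fun n => iSup_le fun msg => ?_
    refine (systemLaw_withCodebook_error_le ν (κ n) m (ζ n) (h n) (W n) _ msg p).trans
      (add_le_add ?_ le_rfl)
    have hsub : {w : Realization A (fun p => Fin n → 𝒳 p.1) 𝒳 𝒴 I O (C n) S |
        w.1.1 p ∉ W n p (decoded (h n) p w)} ⊆ {w | w.1.1 p ∈ (T p n)ᶜ} ∪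
        {w | D p < avgDistortion (d p) (w.1.1 p) (decoded (h n) p w)} := by
      intro w hw
      by_cases hwT : w.1.1 p ∈ T p n
      · refine Or.inr (show D p < avgDistortion (d p) (w.1.1 p) (decoded (h n) p w) from ?_)
        exact lt_of_not_ge fun hle => hw ⟨hwT, hle⟩
      · exact Or.inl hwT
    refine (measure_mono hsub).trans ((measure_union_le _ _).trans (add_le_add ?_ le_rfl))
    exact (sourceLaw_apply_block (h n) m μ ν (κ n) p MeasurableSet.of_discrete).le
  -- the law of the system in which the codewords take the place of the source blocks
  have hlaw : ∀ n, ∃ ψ : Realization A (fun p => Fin n → 𝒳 p.1) 𝒳 𝒴 I O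
      (C n × ∀ p : A, Fin (msgCount (R p) n) → Fin n → 𝒳 p.1) S →
      Realization A (fun p => Fin n → 𝒳 p.1) 𝒳 𝒴 I O (C n) S, Measurable ψ ∧
      (∀ w, unaffected (ψ w) = unaffected w) ∧
      (sourceLaw (fun i => (g n i).withSourceCode (fun p => enc p n) (fun p => dec p n)) m μ ν
        ((κ n).prod (codebookLaw (fun p => msgCount (R p) n) (ζ n)))).map ψ =
        sourceLaw (h n) m μ ν (κ n) := by
    intro n
    have henc : Measurable fun (b : ∀ p : A, Fin n → 𝒳 p.1) p => enc p n (b p) :=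
      Measurable.of_discrete
    have hψ₁ : Measurable fun w : Realization A (fun p => Fin n → 𝒳 p.1) 𝒳 𝒴 I O
        (C n × ∀ p : A, Fin (msgCount (R p) n) → Fin n → 𝒳 p.1) S =>
        (((fun p => enc p n (w.1.1 p)), w.1.2), w.2) :=
      ((henc.comp (by fun_prop)).prodMk (by fun_prop)).prodMk (by fun_prop)
    have hψ₂ : Measurable (Prod.map (substituteCodewords (A := A) (In := fun p => Fin n → 𝒳 p.1)
        (M := fun p => msgCount (R p) n) (𝒳 := 𝒳) (C := C n) (S := S))
        (id : (ℕ → Signal 𝒴 I O) → _)) :=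
      measurable_substituteCodewords.prodMap measurable_id
    -- Encoding and substitution touch only the data and the common randomness, which `unaffected`
    -- does not read.
    refine ⟨_, hψ₂.comp hψ₁, fun w => rfl, ?_⟩
    have : IsProbabilityMeasure ((Measure.pi fun p : A => ζ n p).map
        fun b p => enc p n (b p)) :=
      Measure.isProbabilityMeasure_map henc.aemeasurable
    rw [← Measure.map_map hψ₂ hψ₁]
    refine (congrArg _ (map_systemLaw_withSourceCode _ ν _ m (g n) _ _)).trans ?_
    exact map_systemLaw_withCodebook ν (κ n) m (ζ n) _ (h n) _
  have hun : ∀ n, (sourceLaw (fun i => (g n i).withSourceCode (fun p => enc p n)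
      (fun p => dec p n)) m μ ν ((κ n).prod (codebookLaw (fun p => msgCount (R p) n) (ζ n)))).map
      unaffected = (sourceLaw (h n) m μ ν (κ n)).map unaffected := by
    intro n
    obtain ⟨ψ, hψ, hψu, hmap⟩ := hlaw n
    rw [← hmap, Measure.map_map measurable_unaffected hψ]
    congr 1
    exact (funext hψu).symm
  refine ⟨hrel, fun p => ?_, fun n i => ?_, hun⟩
  · have hlim := (hrel p).add (hcode p)
    rw [add_zero] at hlim
    refine tendsto_of_tendsto_of_tendsto_of_le_of_le tendsto_const_nhds hlim
      (fun _ => zero_le) fun n => ?_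
    refine (systemLaw_withSourceCode_distortion_le ν _ m _ (g n) (fun p => enc p n)
      (fun p => dec p n) p {z | D' p < avgDistortion (d p) z.1 z.2}).trans (add_le_add le_rfl ?_)
    refine le_of_eq ?_
    rw [← (measurePreserving_eval (fun p : A => Measure.pi fun _ : Fin n => μ p) p).map_eq,
      Measure.map_apply (measurable_pi_apply p) MeasurableSet.of_discrete]
    rfl
  · have h1 := congrArg (Measure.map fun z => (z.2 i).1) (hun n)
    rwa [Measure.map_map (by fun_prop) measurable_unaffected,
      Measure.map_map (by fun_prop) measurable_unaffected] at h1
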